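/- Let $\pi$ be a permutation of $\{1,\dots,n\}$, written in one-line notation $\pi(1)\pi(2)\cdots\pi(n)$. It contains the pattern $1324$ if there are positions $i_1<i_2<i_3<i_4$ such that $\pi(i_1)<\pi(i_3)<\pi(i_2)<\pi(i_4)$; otherwise it avoids $1324$. Let $\operatorname{Av}^I_n(1324)$ be the set of all involutions $\pi$ of $\{1,\dots,n\}$ (permutations with $\pi=\pi^{-1}$, the identity included) that avoid $1324$. Then the upper growth rate of the $1324$-avoiding involutions satisfies $$ \overline{\mathrm{gr}}(\operatorname{Av}^I(1324)) \;=\; \limsup_{n\to\infty}\sqrt[n]{\,|\operatorname{Av}^I_n(1324)|\,} \;>\; 3.13 . $$ -/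

import Mathlib

open scoped ENNReal

/-- The permutation `π` of length `n` contains the pattern `σ` of length `k`: some subsequence of
the one-line notation of `π` is order isomorphic to `σ`. -/
def ContainsPattern {n k : ℕ} (π : Equiv.Perm (Fin n)) (σ : Equiv.Perm (Fin k)) : Prop :=
  ∃ f : Fin k → Fin n, StrictMono f ∧ ∀ i j : Fin k, π (f i) < π (f j) ↔ σ i < σ j

/-- `Av^I_n(β)`: the involutions of length `n` (the identity counts as one) that avoid `β`. -/
def avoidingInvolutions {k : ℕ} (β : Equiv.Perm (Fin k)) (n : ℕ) : Set (Equiv.Perm (Fin n)) :=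
  {π | Function.Involutive π ∧ ¬ ContainsPattern π β}

/-- The upper growth rate `limsup_{n → ∞} |C_n|^{1/n}` of a family of sets of permutations, where
`C n` consists of the members of length `n`. It is computed in `[0, ∞]`. -/
noncomputable def upperGrowthRate (C : (n : ℕ) → Set (Equiv.Perm (Fin n))) : ℝ≥0∞ :=
  Filter.limsup (fun n : ℕ => ((C n).ncard : ℝ≥0∞) ^ (1 / (n : ℝ))) Filter.atTop

/-- The pattern `1324`, on the positions and values `0, 1, 2, 3`. -/
def pattern1324 : Equiv.Perm (Fin 4) := Equiv.swap 1 2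

/-- The one-line notation of `pattern1324`, with all values lowered by one. -/
theorem pattern1324_apply : (pattern1324 : Fin 4 → Fin 4) = ![0, 2, 1, 3] := by
  decide

/-! The pattern 1324 is skew-indecomposable and is its own inverse. Hence if `π` avoids it, so does
the involution `π ⊖ π⁻¹` of twice the length (`exists_involution`). Since 3.13² = 9.7969, it
suffices to build 1324-avoiders with growth rate above 9.7969.

The raw material is dominoes: a 132-avoiding cell followed by a 213-avoiding cell, jointly avoiding
1324. They are grown by inserting new maxima. The number of admissible insertions depends only on a
stack, recorded as a word in two letters, so the level sums of the resulting tree satisfy functional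
equations with one catalytic variable. Their solution is `(1 - x)(1 + x)³` with `x = z(1 + x)³`
(`dominoCount_series`), which has growth rate 27/4. Only distinctness and validity of the generated
dominoes are needed, not that all of them arise.

Interleaving the left cell with `k₁` larger values in decreasing order, and the right cell with `k₂`
smaller values in decreasing order, still avoids 1324 and gains two binomial factors
(`IsDomino.isBlock`, `exists_finset_isBlock`). Such blocks can be chained, with consecutive blocks
sharing one of the decreasing sequences (`exists_glue_mem_starters`). Two blocks made from dominoes
with `n` points thus use only `2n + k₁ + k₂` new points, while the number of choices is multiplied
by the square of the number of blocks. Taking each `kᵢ` about 7/15 of its cell makes this square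
exceed `9.7969 ^ (2n + k₁ + k₂)` (`exists_pow_lt_ncard_blocks_sq`). -/

namespace Domino

/-! ### The generating tree of stack words and its functional equations -/

section

open Polynomial

/-- Sum of `φ` over all suffixes of a word that start with `true`. -/
def sumTails {M : Type*} [AddCommMonoid M] (φ : List Bool → M) : List Bool → M
  | [] => 0
  | true :: s => φ (true :: s) + sumTails φ s
  | false :: s => sumTails φ s

/-- Sum of `φ` over the words obtained by deleting an initial part of the letters `false`. -/
def sumDels {M : Type*} [AddCommMonoid M] : (List Bool → M) → List Bool → M
  | φ, [] => φ []
  | φ, true :: s => sumDels (fun y => φ (true :: y)) s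
  | φ, false :: s => φ (false :: s) + sumDels φ s

/-- The transfer operator of the generating tree of dominoes, acting on functions of the stack
word (top of the stack first). -/
def transfer {M : Type*} [AddCommMonoid M] (φ : List Bool → M) (s : List Bool) : M :=
  φ (true :: s) + sumTails φ s + sumDels (fun y => φ (false :: y)) s

/-- `X ^ |s|` if `s` consists of letters `true` only, and `0` otherwise. -/
noncomputable def pureWt : List Bool → ℤ[X]
  | [] => 1
  | true :: s => X * pureWt s
  | false :: _ => 0

/-- Decompose `s = y ++ false :: true ^ i` and return `φ y * X ^ i`. -/
noncomputable def hat : (List Bool → ℤ[X]) → List Bool → ℤ[X]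
  | _, [] => 0
  | φ, true :: s => hat (fun y => φ (true :: y)) s
  | φ, false :: s => hat (fun y => φ (false :: y)) s + φ [] * pureWt s

/-- `X ^ i` on the word `false :: true ^ i`, and `0` on other words. -/
noncomputable def lockWt : List Bool → ℤ[X]
  | false :: s => pureWt s
  | _ => 0

theorem sumTails_add (φ ψ : List Bool → ℤ[X]) (s : List Bool) :
    sumTails (fun y => φ y + ψ y) s = sumTails φ s + sumTails ψ s := by
  induction s with
  | nil => simp [sumTails]
  | cons c s ih => cases c <;> simp only [sumTails, ih]; ring

theorem sumDels_add (φ ψ : List Bool → ℤ[X]) (s : List Bool) :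
    sumDels (fun y => φ y + ψ y) s = sumDels φ s + sumDels ψ s := by
  induction s generalizing φ ψ with
  | nil => simp [sumDels]
  | cons c s ih => cases c <;> simp only [sumDels, ih]; ring

theorem sumDels_mul (c : ℤ[X]) (φ : List Bool → ℤ[X]) (s : List Bool) :
    sumDels (fun y => c * φ y) s = c * sumDels φ s := by
  induction s generalizing φ with
  | nil => simp [sumDels]
  | cons c s ih => cases c <;> simp only [sumDels, ih]; ring

theorem hat_add (φ ψ : List Bool → ℤ[X]) (s : List Bool) :
    hat (fun y => φ y + ψ y) s = hat φ s + hat ψ s := by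
  induction s generalizing φ ψ with
  | nil => simp [hat]
  | cons c s ih => cases c <;> simp only [hat, ih]; ring

theorem hat_mul (c : ℤ[X]) (φ : List Bool → ℤ[X]) (s : List Bool) :
    hat (fun y => c * φ y) s = c * hat φ s := by
  induction s generalizing φ with
  | nil => simp [hat]
  | cons c s ih => cases c <;> simp only [hat, ih]; ring

theorem sumTails_hat (φ : List Bool → ℤ[X]) (s : List Bool) :
    sumTails (hat φ) s = hat (sumTails φ) s := by
  induction s with
  | nil => simp [sumTails, hat]
  | cons c s ih => cases c <;> simp [sumTails, hat, ih, hat_add]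

theorem sumDels_hat (φ : List Bool → ℤ[X]) (s : List Bool) :
    sumDels (hat φ) s = hat (sumDels φ) s := by
  induction s generalizing φ with
  | nil => simp [sumDels, hat]
  | cons c s ih =>
    cases c
    · simp only [sumDels, hat, ih, hat_add]; ring
    · simp only [sumDels, hat, ih]

/-- Look at the bottommost `false` of a child of `s`. If it is already present in `s`, the step took
place above it, as a step of the tree on the upper part. Otherwise it was just pushed after all
other letters `false` had been deleted, which gives the second term. -/
theorem transfer_hat (φ : List Bool → ℤ[X]) (s : List Bool) :
    transfer (hat φ) s = hat (transfer φ) s + φ [] * sumDels pureWt s := by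
  have h : hat (transfer φ) s = hat (fun y => φ (true :: y)) s + hat (sumTails φ) s
      + hat (sumDels (fun y => φ (false :: y))) s := by
    rw [← hat_add, ← hat_add]; rfl
  rw [h]
  simp only [transfer, hat, sumDels_add, sumDels_mul, sumTails_hat]
  rw [sumDels_hat]
  ring

theorem sumTails_lockWt (s : List Bool) : sumTails lockWt s = 0 := by
  induction s with
  | nil => rfl
  | cons c s ih => cases c <;> simp [sumTails, ih, lockWt]

theorem transfer_lockWt (s : List Bool) : transfer lockWt s = sumDels pureWt s := by
  simp [transfer, sumTails_lockWt, lockWt]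

/-- Only the deletion of every `false` contributes, so both sides are `X` to the number of letters
`true`. Either there is no `false`, or the bottommost one is split off. -/
theorem sumDels_pureWt (s : List Bool) :
    sumDels pureWt s = pureWt s + hat (sumDels pureWt) s := by
  induction s with
  | nil => simp [sumDels, hat]
  | cons c s ih =>
    cases c
    · simp only [sumDels, hat, pureWt]
      simp only [zero_add, one_mul, add_comm _ (pureWt s)]
      exact ih
    · simp only [sumDels, hat, pureWt, sumDels_mul, hat_mul]
      nth_rewrite 1 [ih]; ring

/-- If the maximal run of `true` at the bottom has length `i`, the sum is the geometric sum `X + ⋯ +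
X ^ i`, while `pureWt s + hat 1 s` is `X ^ i`. -/
theorem sumTails_pureWt (s : List Bool) :
    (X - 1) * sumTails pureWt s = X * (pureWt s + hat (fun _ => 1) s - 1) := by
  induction s with
  | nil => simp [sumTails, hat, pureWt]
  | cons c s ih =>
    cases c
    · simp only [sumTails, hat, pureWt, ih]; ring
    · simp only [sumTails, hat, pureWt, mul_add, ih]; ring

theorem sumDels_zero (s : List Bool) : sumDels (fun _ => (0 : ℤ[X])) s = 0 := by
  induction s with
  | nil => rfl
  | cons c s ih => cases c <;> simp [sumDels, ih]

theorem transfer_pureWt (s : List Bool) :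
    transfer pureWt s = X * pureWt s + sumTails pureWt s := by
  simp [transfer, pureWt, sumDels_zero]

/-- The sum of `φ` over the words at level `n` of the generating tree. -/
def levelSum {M : Type*} [AddCommMonoid M] (φ : List Bool → M) (n : ℕ) : M :=
  (transfer^[n] φ) []

theorem levelSum_succ {M : Type*} [AddCommMonoid M] (φ : List Bool → M) (n : ℕ) :
    levelSum φ (n + 1) = levelSum (transfer φ) n := rfl

theorem transfer_add (φ ψ : List Bool → ℤ[X]) :
    transfer (fun y => φ y + ψ y) = fun y => transfer φ y + transfer ψ y := by
  funext s
  simp only [transfer, sumTails_add, sumDels_add]; ring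

theorem sumTails_mul (c : ℤ[X]) (φ : List Bool → ℤ[X]) (s : List Bool) :
    sumTails (fun y => c * φ y) s = c * sumTails φ s := by
  induction s with
  | nil => simp [sumTails]
  | cons c s ih => cases c <;> simp only [sumTails, ih]; ring

theorem transfer_mul (c : ℤ[X]) (φ : List Bool → ℤ[X]) :
    transfer (fun y => c * φ y) = fun y => c * transfer φ y := by
  funext s
  simp only [transfer, sumTails_mul, sumDels_mul]; ring

theorem levelSum_add (φ ψ : List Bool → ℤ[X]) (n : ℕ) :
    levelSum (fun y => φ y + ψ y) n = levelSum φ n + levelSum ψ n := by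
  induction n generalizing φ ψ with
  | zero => rfl
  | succ n ih => rw [levelSum_succ, transfer_add, ih]; rfl

theorem levelSum_mul (c : ℤ[X]) (φ : List Bool → ℤ[X]) (n : ℕ) :
    levelSum (fun y => c * φ y) n = c * levelSum φ n := by
  induction n generalizing φ with
  | zero => rfl
  | succ n ih => rw [levelSum_succ, transfer_mul, ih]; rfl

/-- A renewal argument: cut the history at the moment when the final bottommost `false` was pushed.
What happens above it afterwards is an independent copy of the tree started from the empty word. -/
theorem levelSum_hat (φ : List Bool → ℤ[X]) (n : ℕ) :
    levelSum (hat φ) n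
      = ∑ p ∈ Finset.HasAntidiagonal.antidiagonal n, levelSum φ p.1 * levelSum lockWt p.2 := by
  induction n generalizing φ with
  | zero => simp [levelSum, hat, lockWt]
  | succ n ih =>
    have h : transfer (hat φ) = fun s => hat (transfer φ) s + φ [] * transfer lockWt s := by
      funext s; rw [transfer_hat, transfer_lockWt]
    rw [levelSum_succ, h, levelSum_add, levelSum_mul, ih, Finset.Nat.antidiagonal_succ,
      Finset.sum_cons, Finset.sum_map, add_comm]
    rfl

/-- Generating function of the level sums of `φ`. -/
noncomputable def levelSeries (φ : List Bool → ℤ[X]) : PowerSeries ℤ[X] :=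
  PowerSeries.mk (levelSum φ)

theorem levelSeries_hat (φ : List Bool → ℤ[X]) :
    levelSeries (hat φ) = levelSeries φ * levelSeries lockWt := by
  ext1 n
  simp [levelSeries, PowerSeries.coeff_mul, levelSum_hat]

theorem levelSeries_add (φ ψ : List Bool → ℤ[X]) :
    levelSeries (fun y => φ y + ψ y) = levelSeries φ + levelSeries ψ := by
  ext1 n
  simp [levelSeries, levelSum_add]

theorem levelSeries_mul (c : ℤ[X]) (φ : List Bool → ℤ[X]) :
    levelSeries (fun y => c * φ y) = PowerSeries.C c * levelSeries φ := by
  ext1 n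
  simp [levelSeries, levelSum_mul]

theorem levelSeries_eq (φ : List Bool → ℤ[X]) :
    levelSeries φ = PowerSeries.C (φ []) + PowerSeries.X * levelSeries (transfer φ) := by
  ext n : 1
  cases n with
  | zero => simp [levelSeries, levelSum]
  | succ n => simp [levelSeries, levelSum_succ, PowerSeries.coeff_succ_X_mul]

theorem levelSeries_lockWt_eq :
    levelSeries lockWt = PowerSeries.X * levelSeries pureWt
      + levelSeries lockWt * levelSeries lockWt := by
  have h1 : levelSeries lockWt = PowerSeries.X * levelSeries (sumDels pureWt) := by
    conv_lhs => rw [levelSeries_eq]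
    simp [lockWt, funext transfer_lockWt]
  have h2 : levelSeries (sumDels pureWt)
      = levelSeries pureWt + levelSeries (sumDels pureWt) * levelSeries lockWt := by
    conv_lhs => rw [funext sumDels_pureWt]
    rw [levelSeries_add, levelSeries_hat]
  linear_combination h1 + PowerSeries.X * h2 - levelSeries lockWt * h1

/-- This is the catalytic equation. The polynomial variable marks the height of the pure stack, and
the series of the constant 1, which counts all words, is free of it. -/
theorem levelSeries_pureWt_eq :
    (PowerSeries.C (X : ℤ[X]) - 1) * (levelSeries pureWt - 1
        - PowerSeries.X * PowerSeries.C (X : ℤ[X]) * levelSeries pureWt)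
      = PowerSeries.X * PowerSeries.C (X : ℤ[X]) * (levelSeries pureWt
        + levelSeries (fun _ => 1) * levelSeries lockWt - levelSeries (fun _ => 1)) := by
  have h1 : levelSeries pureWt = 1 + PowerSeries.X *
      (PowerSeries.C (X : ℤ[X]) * levelSeries pureWt + levelSeries (sumTails pureWt)) := by
    conv_lhs => rw [levelSeries_eq]
    rw [funext transfer_pureWt, levelSeries_add, levelSeries_mul]
    simp [pureWt]
  have h2 : PowerSeries.C (X - 1 : ℤ[X]) * levelSeries (sumTails pureWt)
      = PowerSeries.C (X : ℤ[X]) * (levelSeries pureWt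
        + (levelSeries (hat fun _ => 1) + PowerSeries.C (-1 : ℤ[X]) * levelSeries (fun _ => 1))) := by
    rw [← levelSeries_mul, ← levelSeries_mul, ← levelSeries_add, ← levelSeries_add,
      ← levelSeries_mul]
    congr 1
    funext s
    rw [sumTails_pureWt]
    ring
  rw [levelSeries_hat] at h2
  simp only [map_sub, map_neg, map_one] at h2
  linear_combination (PowerSeries.C (X : ℤ[X]) - 1) * h1 + PowerSeries.X * h2

end

/-! ### Solving the functional equations -/

section

open Polynomial

/-- The power series `f` and `g` have the same coefficients below degree `n`. -/
def AgreeBelow {R : Type*} [Semiring R] (n : ℕ) (f g : PowerSeries R) : Prop :=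
  ∀ i < n, PowerSeries.coeff i f = PowerSeries.coeff i g

theorem AgreeBelow.refl {R : Type*} [Semiring R] (n : ℕ) (f : PowerSeries R) :
    AgreeBelow n f f := fun _ _ => rfl

theorem AgreeBelow.add {R : Type*} [Semiring R] {n : ℕ} {f g f' g' : PowerSeries R}
    (h : AgreeBelow n f g) (h' : AgreeBelow n f' g') : AgreeBelow n (f + f') (g + g') := by
  intro i hi
  simp [h i hi, h' i hi]

theorem AgreeBelow.mul {R : Type*} [Semiring R] {n : ℕ} {f g f' g' : PowerSeries R}
    (h : AgreeBelow n f g) (h' : AgreeBelow n f' g') : AgreeBelow n (f * f') (g * g') := by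
  intro i hi
  rw [PowerSeries.coeff_mul, PowerSeries.coeff_mul]
  refine Finset.sum_congr rfl fun p hp => ?_
  have := Finset.HasAntidiagonal.mem_antidiagonal.1 hp
  rw [h p.1 (by omega), h' p.2 (by omega)]

theorem AgreeBelow.X_mul {R : Type*} [Semiring R] {n : ℕ} {f g : PowerSeries R}
    (h : AgreeBelow n f g) :
    AgreeBelow (n + 1) (PowerSeries.X * f) (PowerSeries.X * g) := by
  intro i hi
  cases i with
  | zero => simp
  | succ i => simpa [PowerSeries.coeff_succ_X_mul] using h i (by omega)

/-- Banach's fixed point theorem for the adic metric: the iterates from 0 stabilise coefficient by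
coefficient. -/
theorem exists_fixedPoint_of_contracting {R : Type*} [Semiring R]
    (Φ : PowerSeries R → PowerSeries R)
    (hΦ : ∀ n f g, AgreeBelow n f g → AgreeBelow (n + 1) (Φ f) (Φ g)) : ∃ f, Φ f = f := by
  have hstep : ∀ n k, AgreeBelow n (Φ^[n] 0) (Φ^[n + k] 0) := by
    intro n
    induction n with
    | zero => intro k i hi; omega
    | succ n ih =>
      intro k
      rw [show n + 1 + k = (n + k) + 1 by omega, Function.iterate_succ_apply',
        Function.iterate_succ_apply']
      exact hΦ _ _ _ (ih k)
  let f : PowerSeries R := PowerSeries.mk fun n => PowerSeries.coeff n (Φ^[n + 1] 0)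
  have hf : ∀ n, AgreeBelow n f (Φ^[n] 0) := by
    intro n i hi
    obtain ⟨k, rfl⟩ : ∃ k, n = i + 1 + k := ⟨n - (i + 1), by omega⟩
    rw [PowerSeries.coeff_mk]
    exact hstep (i + 1) k i (by omega)
  refine ⟨f, ?_⟩
  ext n
  have h1 := hΦ _ _ _ (hf n) n (by omega)
  have h2 := hf (n + 1) n (by omega)
  rw [h1, h2, Function.iterate_succ_apply']

theorem exists_ternarySeries :
    ∃ x : PowerSeries ℕ, x = PowerSeries.X * ((1 + x) * ((1 + x) * (1 + x))) := by
  obtain ⟨x, hx⟩ := exists_fixedPoint_of_contracting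
    (fun x : PowerSeries ℕ => PowerSeries.X * ((1 + x) * ((1 + x) * (1 + x)))) (by
      intro n f g h
      have h1 := (AgreeBelow.refl n (1 : PowerSeries ℕ)).add h
      exact (h1.mul (h1.mul h1)).X_mul)
  exact ⟨x, hx.symm⟩

/-- Uniqueness replaces the kernel method: it then suffices to exhibit one solution. Two solutions
are shown to agree modulo every power of the series variable, each equation improving the precision
by one. -/
theorem eq_of_functional_equations {A A' B B' : PowerSeries ℤ[X]} {M M' : PowerSeries ℤ}
    (hB : PowerSeries.X ∣ B) (hB' : PowerSeries.X ∣ B')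
    (h2 : B = PowerSeries.X * A + B * B) (h2' : B' = PowerSeries.X * A' + B' * B')
    (h1 : (PowerSeries.C (X : ℤ[X]) - 1) * (A - 1 - PowerSeries.X * PowerSeries.C (X : ℤ[X]) * A)
      = PowerSeries.X * PowerSeries.C (X : ℤ[X])
        * (A + PowerSeries.map C M * B - PowerSeries.map C M))
    (h1' : (PowerSeries.C (X : ℤ[X]) - 1)
        * (A' - 1 - PowerSeries.X * PowerSeries.C (X : ℤ[X]) * A')
      = PowerSeries.X * PowerSeries.C (X : ℤ[X])
        * (A' + PowerSeries.map C M' * B' - PowerSeries.map C M')) :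
    M = M' := by
  have key : ∀ n : ℕ, (PowerSeries.X : PowerSeries ℤ[X]) ^ n ∣ A - A' ∧
      (PowerSeries.X : PowerSeries ℤ[X]) ^ n ∣ B - B' ∧
      (PowerSeries.X : PowerSeries ℤ) ^ n ∣ M - M' := by
    intro n
    induction n with
    | zero => simp
    | succ n ih =>
      obtain ⟨hA, hBn, hM⟩ := ih
      have hMC : (PowerSeries.X : PowerSeries ℤ[X]) ^ n
          ∣ PowerSeries.map C M - PowerSeries.map C M' := by
        have := map_dvd (PowerSeries.map (C : ℤ →+* ℤ[X])) hM
        simpa using this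
      have hB1 : (PowerSeries.X : PowerSeries ℤ[X]) ^ (n + 1) ∣ B - B' := by
        have e : B - B' = PowerSeries.X * (A - A') + (B - B') * (B + B') := by
          linear_combination h2 - h2'
        rw [e]
        refine dvd_add ?_ ?_
        · rw [pow_succ']; exact mul_dvd_mul_left _ hA
        · rw [pow_succ]; exact mul_dvd_mul hBn (dvd_add hB hB')
      -- The right side of the catalytic equation has a factor of the series variable; the factor `X
      -- - 1` on the left is nonzero in the domain `ℤ[X]` and cancels in each coefficient.
      have hA1 : (PowerSeries.X : PowerSeries ℤ[X]) ^ (n + 1) ∣ A - A' := by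
        have e : PowerSeries.C (X - 1 : ℤ[X]) * (A - A')
            = PowerSeries.X * (PowerSeries.C (X : ℤ[X]) * ((PowerSeries.C (X : ℤ[X])) * (A - A')
              + (PowerSeries.map C M - PowerSeries.map C M') * B
              + PowerSeries.map C M' * (B - B') - (PowerSeries.map C M - PowerSeries.map C M'))) := by
          simp only [map_sub, map_one]
          linear_combination h1 - h1'
        have hd : (PowerSeries.X : PowerSeries ℤ[X]) ^ (n + 1)
            ∣ PowerSeries.C (X - 1 : ℤ[X]) * (A - A') := by
          rw [e, pow_succ']
          refine mul_dvd_mul_left _ (Dvd.dvd.mul_left ?_ _)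
          exact dvd_sub (dvd_add (dvd_add (hA.mul_left _) (hMC.mul_right _)) (hBn.mul_left _)) hMC
        rw [PowerSeries.X_pow_dvd_iff] at hd ⊢
        intro i hi
        have := hd i hi
        rw [PowerSeries.coeff_C_mul, mul_eq_zero] at this
        exact this.resolve_left (X_sub_C_ne_zero (1 : ℤ))
      -- Setting the catalytic variable to 1 kills the left side and leaves `M = A(1) + M * B(1)`,
      -- where `B(1)` is divisible by the series variable.
      refine ⟨hA1, hB1, ?_⟩
      set ev := PowerSeries.map (evalRingHom (1 : ℤ)) with hev
      have evC : ∀ S : PowerSeries ℤ, ev (PowerSeries.map C S) = S := by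
        intro S; ext i; simp [hev]
      have hA2 := map_dvd ev hA1
      have hB2 := map_dvd ev hB1
      have e1 := congrArg ev h1
      have e1' := congrArg ev h1'
      simp only [map_mul, map_sub, map_add, map_one, evC] at e1 e1'
      simp only [hev, PowerSeries.map_C, PowerSeries.map_X, coe_evalRingHom, eval_X, map_one,
        sub_self, zero_mul, mul_one] at e1 e1'
      rw [← hev] at e1 e1'
      have e2 := (mul_eq_zero.1 e1.symm).resolve_left PowerSeries.X_ne_zero
      have e2' := (mul_eq_zero.1 e1'.symm).resolve_left PowerSeries.X_ne_zero
      have e : M - M' = ev (A - A') + (M - M') * ev B + M' * ev (B - B') := by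
        simp only [map_sub]
        linear_combination e2' - e2
      rw [e]
      simp only [map_pow, hev, PowerSeries.map_X] at hA2 hB2
      refine dvd_add (dvd_add hA2 ?_) (hB2.mul_left _)
      rw [pow_succ]
      refine mul_dvd_mul hM ?_
      have := map_dvd ev hB
      simpa [hev] using this
  ext n
  have := PowerSeries.X_pow_dvd_iff.1 (key (n + 1)).2.2 n (by omega)
  rw [map_sub] at this
  exact sub_eq_zero.1 this

/-- The number of words at level `n` of the generating tree of dominoes. -/
def dominoCount (n : ℕ) : ℕ := levelSum (fun _ => 1) n

theorem cast_sumTails (φ : List Bool → ℕ) (s : List Bool) :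
    ((sumTails φ s : ℕ) : ℤ[X]) = sumTails (fun y => (φ y : ℤ[X])) s := by
  induction s with
  | nil => simp [sumTails]
  | cons c s ih => cases c <;> simp [sumTails, ih]

theorem cast_sumDels (φ : List Bool → ℕ) (s : List Bool) :
    ((sumDels φ s : ℕ) : ℤ[X]) = sumDels (fun y => (φ y : ℤ[X])) s := by
  induction s generalizing φ with
  | nil => simp [sumDels]
  | cons c s ih => cases c <;> simp [sumDels, ih]

theorem cast_levelSum (φ : List Bool → ℕ) (n : ℕ) :
    ((levelSum φ n : ℕ) : ℤ[X]) = levelSum (fun y => (φ y : ℤ[X])) n := by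
  induction n generalizing φ with
  | zero => rfl
  | succ n ih =>
    rw [levelSum_succ, levelSum_succ, ih]
    congr 1
    funext s
    simp [transfer, cast_sumTails, cast_sumDels]

theorem dominoCount_series (x : PowerSeries ℤ)
    (hx : x = PowerSeries.X * (1 + x) ^ 3) :
    PowerSeries.mk (fun n => (dominoCount n : ℤ)) = (1 - x) * (1 + x) ^ 3 := by
  set y : PowerSeries ℤ[X] := PowerSeries.map C x with hy
  set u : PowerSeries ℤ[X] := PowerSeries.C (X : ℤ[X]) with hu
  have hyz : y = PowerSeries.X * (1 + y) ^ 3 := by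
    have := congrArg (PowerSeries.map (C : ℤ →+* ℤ[X])) hx
    simpa using this
  -- With `B' = 1 - q` the first equation says `q(1 - q) = zA'`; putting `q = 1/(1 + ys)` turns this
  -- into `A' = (1 + y)³ s q²`. The catalytic equation is then quadratic in `s`, and after `s = 1 +
  -- y(u - 1 - y)m` it is a multiple of `(u - 1 - y)²` times the quadratic equation defining `m`.
  obtain ⟨m, hm⟩ := exists_fixedPoint_of_contracting
    (fun m : PowerSeries ℤ[X] => 1 + PowerSeries.X * ((1 + y) ^ 3 * ((u - y) * m
      + y ^ 2 * (u - 1) * (m * m)))) (by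
      intro n f g h
      refine (AgreeBelow.refl _ _).add (AgreeBelow.X_mul ?_)
      exact (AgreeBelow.refl _ _).mul (((AgreeBelow.refl _ _).mul h).add
        ((AgreeBelow.refl _ _).mul (h.mul h))))
  have hm' : m = 1 + y * ((u - y) * m + y ^ 2 * (u - 1) * m ^ 2) := by
    linear_combination -hm - ((u - y) * m + y ^ 2 * (u - 1) * m ^ 2) * hyz
  clear hm
  set s := 1 + y * (u - 1 - y) * m with hs
  have hr : IsUnit (1 + y * s) := by
    rw [PowerSeries.isUnit_iff_constantCoeff, hyz]
    simp
  obtain ⟨q, hq⟩ := hr.exists_right_inv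
  refine eq_of_functional_equations (A := levelSeries pureWt) (B := levelSeries lockWt)
    (A' := (1 + y) ^ 3 * s * q ^ 2) (B' := 1 - q) ?_ ?_ levelSeries_lockWt_eq ?_ ?_ ?_
  · rw [PowerSeries.X_dvd_iff]
    simp [levelSeries, ← PowerSeries.coeff_zero_eq_constantCoeff_apply, levelSum, lockWt]
  · have : 1 - q = PowerSeries.X * ((1 + y) ^ 3 * s * q) := by
      linear_combination (-1 : PowerSeries ℤ[X]) * hq + s * q * hyz
    rw [this]; exact dvd_mul_right _ _
  · linear_combination -q * hq + s * q ^ 2 * hyz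
  · have : PowerSeries.map C (PowerSeries.mk fun n => (dominoCount n : ℤ))
        = levelSeries (fun _ => 1) := by
      ext1 n
      simp only [PowerSeries.coeff_map, PowerSeries.coeff_mk, levelSeries, dominoCount]
      have := cast_levelSum (fun _ => 1) n
      simpa using this
    rw [this, levelSeries_pureWt_eq]
  · simp only [map_mul, map_sub, map_add, map_pow, map_one, ← hy]
    linear_combination ((u - 1) * u * s * q ^ 2 + u * s * q ^ 2 - u * (1 - y) * q) * hyz
      + ((u - 1) * ((1 + y * s) * q + 1) - u * (1 - y) * y * q) * hq
      + q ^ 2 * y * (u - 1 - y) ^ 2 * hm'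

end

/-! ### Growth of the number of generated dominoes -/

/-- The sum of the power series `f` at the real number `z` is `a`. -/
def HasValue (f : PowerSeries ℕ) (z a : ℝ) : Prop :=
  HasSum (fun n => ((PowerSeries.coeff n f : ℕ) : ℝ) * z ^ n) a

theorem HasValue.mul {f g : PowerSeries ℕ} {z a b : ℝ} (hz : 0 ≤ z) (hf : HasValue f z a)
    (hg : HasValue g z b) : HasValue (f * g) z (a * b) := by
  have hf' : Summable fun n => ‖((PowerSeries.coeff n f : ℕ) : ℝ) * z ^ n‖ := by
    simpa [abs_of_nonneg hz] using hf.summable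
  have hg' : Summable fun n => ‖((PowerSeries.coeff n g : ℕ) : ℝ) * z ^ n‖ := by
    simpa [abs_of_nonneg hz] using hg.summable
  have hs := summable_sum_mul_antidiagonal_of_summable_norm' hf' hf.summable hg' hg.summable
  have ht := tsum_mul_tsum_eq_tsum_sum_antidiagonal_of_summable_norm hf' hg'
  rw [hf.tsum_eq, hg.tsum_eq] at ht
  have e : (fun n => ∑ kl ∈ Finset.HasAntidiagonal.antidiagonal n,
      ((PowerSeries.coeff kl.1 f : ℕ) : ℝ) * z ^ kl.1 * (((PowerSeries.coeff kl.2 g : ℕ) : ℝ) * z ^ kl.2))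
      = fun n => ((PowerSeries.coeff n (f * g) : ℕ) : ℝ) * z ^ n := by
    funext n
    rw [PowerSeries.coeff_mul, Nat.cast_sum, Finset.sum_mul]
    refine Finset.sum_congr rfl fun p hp => ?_
    rw [← Finset.HasAntidiagonal.mem_antidiagonal.1 hp, pow_add]
    push_cast; ring
  rw [e] at hs ht
  rw [HasValue, ht]
  exact hs.hasSum

theorem HasValue.X_mul {f : PowerSeries ℕ} {z a : ℝ} (hf : HasValue f z a) :
    HasValue (PowerSeries.X * f) z (z * a) := by
  rw [HasValue, ← hasSum_nat_add_iff' 1]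
  have := HasSum.mul_left z hf
  simp only [PowerSeries.coeff_succ_X_mul, Finset.range_one, Finset.sum_singleton]
  have e : (fun n => ((PowerSeries.coeff n f : ℕ) : ℝ) * z ^ (n + 1))
      = fun n => z * (((PowerSeries.coeff n f : ℕ) : ℝ) * z ^ n) := by
    funext n; ring
  rw [e]
  simpa using this

theorem HasValue.one_add {f : PowerSeries ℕ} {z a : ℝ} (hf : HasValue f z a) :
    HasValue (1 + f) z (1 + a) := by
  have h1 : HasValue 1 z 1 := by
    have := hasSum_ite_eq (0 : ℕ) (1 : ℝ)
    rw [HasValue]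
    convert this using 1
    funext n
    rcases n with _ | n <;> simp [PowerSeries.coeff_one]
  rw [HasValue]
  convert HasSum.add h1 hf using 1
  funext n
  simp [add_mul]

/-- Otherwise the series converges at 0.1485, which lies between 4/27 and 1/6.72. Its value there
would solve `a = 0.1485 (1 + a)³`, impossible for `a ≥ 0` beyond 4/27. -/
theorem frequently_coeff_ternarySeries (x : PowerSeries ℕ)
    (hx : x = PowerSeries.X * ((1 + x) * ((1 + x) * (1 + x)))) :
    ∃ᶠ n in Filter.atTop, (6.72 : ℝ) ^ n ≤ (PowerSeries.coeff n x : ℕ) := by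
  intro hcon
  have hs : Summable fun n => ((PowerSeries.coeff n x : ℕ) : ℝ) * (0.1485 : ℝ) ^ n := by
    refine Summable.of_norm_bounded_eventually_nat
      (summable_geometric_of_lt_one (r := 6.72 * 0.1485) (by norm_num) (by norm_num)) ?_
    filter_upwards [hcon] with n hn
    rw [mul_pow, Real.norm_of_nonneg (by positivity)]
    exact mul_le_mul_of_nonneg_right (le_of_lt (not_le.1 hn)) (by positivity)
  obtain ⟨a, ha⟩ := hs
  have ha0 : 0 ≤ a := ha.nonneg fun n => by positivity
  have h1 := HasValue.one_add (f := x) ha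
  have h2 := (h1.mul (by norm_num) (h1.mul (by norm_num) h1)).X_mul
  rw [← hx] at h2
  have := HasSum.unique ha h2
  -- The identity used is `(1 + a)³ - (27/4)a = (a - 1/2)²(a + 4)`.
  nlinarith [mul_nonneg ha0 (sq_nonneg (a - 1 / 2)), sq_nonneg (a - 1 / 2)]

/-- Differentiating the closed form gives `2(1 + x)⁶`, so `n * dominoCount n` is its coefficient of
degree `n - 1`. This dominates the same coefficient of `(1 + x)³`, which is the coefficient of
degree `n` in `x`. -/
theorem coeff_ternarySeries_le (x : PowerSeries ℕ)
    (hx : x = PowerSeries.X * ((1 + x) * ((1 + x) * (1 + x)))) (n : ℕ) :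
    PowerSeries.coeff n x ≤ n * dominoCount n := by
  cases n with
  | zero => rw [hx]; simp
  | succ n =>
    set y : PowerSeries ℤ := PowerSeries.map (Nat.castRingHom ℤ) x with hy
    have hyz : y = PowerSeries.X * (1 + y) ^ 3 := by
      have := congrArg (PowerSeries.map (Nat.castRingHom ℤ)) hx
      simp only [map_mul, map_add, map_one, PowerSeries.map_X] at this
      linear_combination this
    have hM := dominoCount_series y hyz
    have hd := congrArg (PowerSeries.derivative ℤ) hM
    have hdy := congrArg (PowerSeries.derivative ℤ) hyz
    simp only [Derivation.leibniz, Derivation.leibniz_pow, map_sub, map_add,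
      PowerSeries.derivative_one, PowerSeries.derivative_X, smul_eq_mul, nsmul_eq_mul] at hd hdy
    norm_num at hd hdy
    set D := PowerSeries.derivative ℤ y
    have h1 : (1 - 2 * y) * D = (1 + y) ^ 4 := by
      linear_combination (1 + y) * hdy - 3 * D * hyz
    have h2 : PowerSeries.derivative ℤ (PowerSeries.mk fun n => (dominoCount n : ℤ))
        = 2 * (1 + y) ^ 6 := by
      linear_combination hd + 2 * (1 + y) ^ 2 * h1
    have h3 : (2 * (1 + y) ^ 6 : PowerSeries ℤ)
        = PowerSeries.map (Nat.castRingHom ℤ) (2 * ((1 + x) * ((1 + x) * (1 + x)) *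
          ((1 + x) * ((1 + x) * (1 + x))))) := by
      simp only [map_mul, map_add, map_one, map_ofNat, ← hy]; ring
    have h4 := congrArg (PowerSeries.coeff n) (h2.trans h3)
    rw [PowerSeries.coeff_derivative, PowerSeries.coeff_mk, PowerSeries.coeff_map] at h4
    have h5 : dominoCount (n + 1) * (n + 1) = PowerSeries.coeff n (2 * ((1 + x) * ((1 + x)
        * (1 + x)) * ((1 + x) * ((1 + x) * (1 + x))))) := by
      apply Nat.cast_injective (R := ℤ)
      rw [← Nat.coe_castRingHom, ← h4]; push_cast; rfl
    set f := (1 + x) * ((1 + x) * (1 + x)) with hf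
    have hx0 : PowerSeries.constantCoeff x = 0 := by rw [hx]; simp
    have hf0 : PowerSeries.coeff 0 f = 1 := by simp [hf, hx0]
    have h6 : PowerSeries.coeff (n + 1) x = PowerSeries.coeff n f := by
      rw [hx, PowerSeries.coeff_succ_X_mul]
    have h7 : PowerSeries.coeff n f ≤ PowerSeries.coeff n (f * f) := by
      rw [PowerSeries.coeff_mul n f f]
      have := Finset.single_le_sum (f := fun p : ℕ × ℕ =>
        PowerSeries.coeff p.1 f * PowerSeries.coeff p.2 f) (fun _ _ => Nat.zero_le _)
        (a := (n, 0)) (Finset.HasAntidiagonal.mem_antidiagonal.2 (add_zero n))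
      simpa only [hf0, mul_one] using this
    rw [two_mul, map_add] at h5
    rw [h6, mul_comm]
    omega

theorem frequently_dominoCount :
    ∃ᶠ n : ℕ in Filter.atTop, (6.72 : ℝ) ^ n ≤ n * dominoCount n := by
  obtain ⟨x, hx⟩ := exists_ternarySeries
  refine (frequently_coeff_ternarySeries x hx).mono fun n hn => hn.trans ?_
  exact_mod_cast coeff_ternarySeries_le x hx n

/-! ### Avoidance in lists under insertion of a maximum -/

/-- The list `l` has no subsequence order isomorphic to `132`. -/
def Avoids132 (l : List ℕ) : Prop :=
  ∀ a b c, [a, c, b].Sublist l → a < b → b < c → False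

/-- The list `l` has no subsequence order isomorphic to `213`. -/
def Avoids213 (l : List ℕ) : Prop :=
  ∀ a b c, [b, a, c].Sublist l → a < b → b < c → False

/-- The list `l` has no subsequence order isomorphic to `1324`. -/
def Avoids1324 (l : List ℕ) : Prop :=
  ∀ a b c d, [a, c, b, d].Sublist l → a < b → b < c → c < d → False

theorem sublist_of_sublist_insert {s X Y : List ℕ} {n : ℕ} (h : s.Sublist (X ++ n :: Y))
    (hn : n ∉ s) : s.Sublist (X ++ Y) := by
  have h1 := h.filter (fun x => decide (x ≠ n))
  rw [List.filter_eq_self.2 (by intro a ha; simpa using fun e : a = n => hn (e ▸ ha))] at h1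
  refine h1.trans ?_
  simp only [List.filter_append, List.filter_cons, ne_eq, not_true_eq_false, decide_false]
  exact List.filter_sublist.append List.filter_sublist

theorem sublist_split_insert {s t X Y : List ℕ} {n : ℕ} (hX : n ∉ X) (hY : n ∉ Y)
    (h : (s ++ n :: t).Sublist (X ++ n :: Y)) : s.Sublist X ∧ t.Sublist Y := by
  induction X generalizing s with
  | nil =>
    cases s with
    | nil => exact ⟨List.Sublist.refl _, by simpa using h⟩
    | cons a s =>
      have h' : (s ++ n :: t).Sublist Y := by
        have := h.tail
        simpa using this
      exact absurd (h'.subset (by simp)) hY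
  | cons x X ih =>
    have hx : n ≠ x := fun e => hX (e ▸ List.mem_cons_self)
    have hX' : n ∉ X := fun e => hX (List.mem_cons_of_mem _ e)
    rw [List.cons_append, List.sublist_cons_iff] at h
    rcases h with h | ⟨r, hr, h⟩
    · exact ⟨(ih hX' h).1.cons x, (ih hX' h).2⟩
    · cases s with
      | nil => simp only [List.nil_append, List.cons.injEq] at hr; exact absurd hr.1 hx
      | cons a s =>
        simp only [List.cons_append, List.cons.injEq] at hr
        obtain ⟨rfl, rfl⟩ := hr
        exact ⟨(ih hX' h).1.cons_cons a, (ih hX' h).2⟩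

theorem Avoids132.insert_max {X Y : List ℕ} {n : ℕ} (h : Avoids132 (X ++ Y))
    (hn : ∀ x ∈ X ++ Y, x < n) (hXY : ∀ x ∈ X, ∀ y ∈ Y, y < x) : Avoids132 (X ++ n :: Y) := by
  intro a b c hs hab hbc
  have hX : n ∉ X := fun e => absurd (hn n (by simp [e])) (lt_irrefl _)
  have hY : n ∉ Y := fun e => absurd (hn n (by simp [e])) (lt_irrefl _)
  by_cases hc : c = n
  · subst hc
    obtain ⟨h1, h2⟩ := sublist_split_insert (s := [a]) (t := [b]) hX hY hs
    exact absurd (hXY a (h1.subset (by simp)) b (h2.subset (by simp))) (by omega)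
  · have hcm : c ∈ X ++ n :: Y := hs.subset (by simp)
    have hcn : c < n := hn c (by simp at hcm ⊢; tauto)
    exact h a b c (sublist_of_sublist_insert hs (by simp; omega)) hab hbc

theorem Avoids213.insert_max {X Y : List ℕ} {n : ℕ} (h : Avoids213 (X ++ Y))
    (hn : ∀ x ∈ X ++ Y, x < n) (hX' : X.Pairwise (· < ·)) : Avoids213 (X ++ n :: Y) := by
  intro a b c hs hab hbc
  have hX : n ∉ X := fun e => absurd (hn n (by simp [e])) (lt_irrefl _)
  have hY : n ∉ Y := fun e => absurd (hn n (by simp [e])) (lt_irrefl _)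
  by_cases hc : c = n
  · subst hc
    obtain ⟨h1, -⟩ := sublist_split_insert (s := [b, a]) (t := []) hX hY hs
    have := hX'.sublist h1
    simp at this; omega
  · have hcm : c ∈ X ++ n :: Y := hs.subset (by simp)
    have hcn : c < n := hn c (by simp at hcm ⊢; tauto)
    exact h a b c (sublist_of_sublist_insert hs (by simp; omega)) hab hbc

/-- In an occurrence a new maximum can only play the 4, so only a 132 in front of it is harmful. -/
theorem Avoids1324.insert_max {X Y : List ℕ} {n : ℕ} (h : Avoids1324 (X ++ Y))
    (hn : ∀ x ∈ X ++ Y, x < n) (hX' : Avoids132 X) : Avoids1324 (X ++ n :: Y) := by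
  intro a b c d hs hab hbc hcd
  have hX : n ∉ X := fun e => absurd (hn n (by simp [e])) (lt_irrefl _)
  have hY : n ∉ Y := fun e => absurd (hn n (by simp [e])) (lt_irrefl _)
  by_cases hd : d = n
  · subst hd
    obtain ⟨h1, -⟩ := sublist_split_insert (s := [a, c, b]) (t := []) hX hY hs
    exact hX' a b c h1 hab hbc
  · have hdm : d ∈ X ++ n :: Y := hs.subset (by simp)
    have hdn : d < n := hn d (by simp at hdm ⊢; tauto)
    exact h a b c d (sublist_of_sublist_insert hs (by simp; omega)) hab hbc hcd

/-! ### Growing dominoes on a stack -/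

/-- An entry of the stack of a partially built domino: a skew component of the left cell, or a
point of the initial increasing run of the right cell. -/
inductive Item where
  | seg (S : List ℕ)
  | pt (c : ℕ)

/-- The concatenation of the skew components in a stack. -/
def segs : List Item → List ℕ
  | [] => []
  | .seg S :: u => S ++ segs u
  | .pt _ :: u => segs u

/-- The points in a stack, from the bottom to the top. -/
def pts : List Item → List ℕ
  | [] => []
  | .seg _ :: u => pts u
  | .pt c :: u => pts u ++ [c]

/-- The stack word of a stack. -/
def shape : List Item → List Bool
  | [] => []
  | .seg _ :: u => true :: shape u
  | .pt _ :: u => false :: shape u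

/-- A partially built domino. -/
structure State where
  items : List Item
  rest : List ℕ

/-- The left cell. -/
def State.left (σ : State) : List ℕ := segs σ.items

/-- The right cell. -/
def State.right (σ : State) : List ℕ := pts σ.items ++ σ.rest

/-- Insert `n` into the left cell after one of the skew components. -/
def touches (n : ℕ) : List ℕ → List ℕ → List Item → List State
  | _, _, [] => []
  | acc, rest, .seg S :: u =>
      ⟨.seg (acc ++ S ++ [n]) :: u, rest⟩ :: touches n (acc ++ S) rest u
  | acc, rest, .pt c :: u => touches n acc (c :: rest) u

/-- Remove some of the topmost points from the stack. -/
def dels : List ℕ → List Item → List State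
  | rest, [] => [⟨[], rest⟩]
  | rest, .seg S :: u => (dels rest u).map fun σ => ⟨.seg S :: σ.items, σ.rest⟩
  | rest, .pt c :: u => ⟨.pt c :: u, rest⟩ :: dels (c :: rest) u

/-- The ways to insert the new maximum `n`. -/
def children (n : ℕ) (σ : State) : List State :=
  ⟨.seg [n] :: σ.items, σ.rest⟩ :: (touches n [] σ.rest σ.items ++
    (dels σ.rest σ.items).map fun τ => ⟨.pt n :: τ.items, τ.rest⟩)

theorem sum_touches (φ : List Bool → ℕ) (n : ℕ) (u : List Item) (acc rest : List ℕ) :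
    ((touches n acc rest u).map fun σ => φ (shape σ.items)).sum = sumTails φ (shape u) := by
  induction u generalizing acc rest with
  | nil => rfl
  | cons i u ih => cases i <;> simp [touches, shape, sumTails, ih]

theorem sum_dels (φ : List Bool → ℕ) (u : List Item) (rest : List ℕ) :
    ((dels rest u).map fun σ => φ (shape σ.items)).sum = sumDels φ (shape u) := by
  induction u generalizing φ rest with
  | nil => simp [dels, shape, sumDels]
  | cons i u ih =>
    cases i with
    | seg S =>
      simp only [dels, shape, sumDels, List.map_map]
      exact ih (fun y => φ (true :: y)) rest
    | pt c => simp [dels, shape, sumDels, ih]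

/-- The shapes of the children depend only on the shape of the parent, so the construction is
counted by the tree of words. -/
theorem sum_children (φ : List Bool → ℕ) (n : ℕ) (σ : State) :
    ((children n σ).map fun τ => φ (shape τ.items)).sum = transfer φ (shape σ.items) := by
  simp only [children, List.map_cons, List.sum_cons, List.map_append, List.sum_append,
    sum_touches, List.map_map, transfer, shape, add_assoc]
  congr 2
  exact sum_dels (fun y => φ (false :: y)) _ _

/-- The partially built dominoes with `n` points. -/
def states : ℕ → List State
  | 0 => [⟨[], []⟩]
  | n + 1 => (states n).flatMap (children n)

theorem sum_states (φ : List Bool → ℕ) (n : ℕ) :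
    ((states n).map fun τ => φ (shape τ.items)).sum = levelSum φ n := by
  induction n generalizing φ with
  | zero => simp [states, levelSum, shape]
  | succ n ih =>
    rw [levelSum_succ, ← ih, states]
    simp only [← sum_children φ n, List.map_flatMap]
    induction states n with
    | nil => rfl
    | cons σ l ih' => simp [ih']

theorem length_states (n : ℕ) : (states n).length = dominoCount n := by
  rw [dominoCount, ← sum_states]
  simp

theorem segs_append (u v : List Item) : segs (u ++ v) = segs u ++ segs v := by
  induction u with
  | nil => rfl
  | cons i u ih => cases i <;> simp [segs, ih]

theorem pts_append (u v : List Item) : pts (u ++ v) = pts v ++ pts u := by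
  induction u with
  | nil => simp [pts]
  | cons i u ih => cases i <;> simp [pts, ih]

theorem mem_segs {x : ℕ} {u : List Item} : x ∈ segs u ↔ ∃ S, .seg S ∈ u ∧ x ∈ S := by
  induction u with
  | nil => simp [segs]
  | cons i u ih => cases i <;> simp [segs, ih, or_and_right, exists_or]

theorem mem_pts {x : ℕ} {u : List Item} : x ∈ pts u ↔ .pt x ∈ u := by
  induction u with
  | nil => simp [pts]
  | cons i u ih => cases i <;> simp [pts, ih, or_comm]

theorem exists_of_mem_touches {n : ℕ} {σ : State} {acc rest : List ℕ} {u : List Item}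
    (h : σ ∈ touches n acc rest u) : ∃ v S w, u = v ++ .seg S :: w ∧
      σ = ⟨.seg (acc ++ segs v ++ S ++ [n]) :: w, pts v ++ rest⟩ := by
  induction u generalizing acc rest with
  | nil => simp [touches] at h
  | cons i u ih =>
    cases i with
    | seg S =>
      rcases List.mem_cons.1 h with rfl | h
      · exact ⟨[], S, u, rfl, by simp [segs, pts]⟩
      · obtain ⟨v, S', w, rfl, rfl⟩ := ih h
        exact ⟨.seg S :: v, S', w, rfl, by simp [segs, pts]⟩
    | pt c =>
      obtain ⟨v, S', w, rfl, rfl⟩ := ih h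
      exact ⟨.pt c :: v, S', w, rfl, by simp [segs, pts]⟩

theorem exists_of_mem_dels {σ : State} {rest : List ℕ} {u : List Item}
    (h : σ ∈ dels rest u) : ∃ t, pts u = pts σ.items ++ t ∧ σ.rest = t ++ rest ∧
      segs σ.items = segs u ∧ σ.items.Sublist u := by
  induction u generalizing rest σ with
  | nil =>
    simp only [dels, List.mem_singleton] at h
    subst h
    exact ⟨[], by simp⟩
  | cons i u ih =>
    cases i with
    | seg S =>
      obtain ⟨τ, hτ, rfl⟩ := List.mem_map.1 h
      obtain ⟨t, h1, h2, h3, h4⟩ := ih hτ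
      exact ⟨t, h1, h2, by simp [segs, h3], h4.cons_cons _⟩
    | pt c =>
      rcases List.mem_cons.1 h with rfl | h
      · exact ⟨[], by simp⟩
      · obtain ⟨t, h1, h2, h3, h4⟩ := ih h
        exact ⟨t ++ [c], by simp [pts, h1], by simp [h2], by simp [segs, h3], h4.cons _⟩

/-- The order relation between an item and an item below it in the stack. -/
def Above : Item → Item → Prop
  | .seg S, .seg S' => ∀ s ∈ S, ∀ s' ∈ S', s' < s
  | .seg S, .pt c => ∀ s ∈ S, c < s
  | .pt c, .pt c' => c' < c
  | .pt _, .seg _ => True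

theorem pairwise_pts {u : List Item} (h : u.Pairwise Above) : (pts u).Pairwise (· < ·) := by
  induction u with
  | nil => simp [pts]
  | cons i u ih =>
    rw [List.pairwise_cons] at h
    cases i with
    | seg S => exact ih h.2
    | pt c =>
      simp only [pts, List.pairwise_append, List.pairwise_singleton, List.mem_singleton, true_and]
      refine ⟨ih h.2, ?_⟩
      rintro a ha b rfl
      exact h.1 _ (mem_pts.1 ha)

/-- A pair of lists of the numbers below `n` that forms a domino: two adjacent cells, the left one
avoiding `132` and the right one avoiding `213`, that together avoid `1324`. -/
structure IsDomino (n : ℕ) (l r : List ℕ) : Prop where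
  perm : (l ++ r).Perm (List.range n)
  avoids132 : Avoids132 l
  avoids213 : Avoids213 r
  avoids1324 : Avoids1324 (l ++ r)

/-- The invariants of the construction of dominoes. -/
structure State.Good (n : ℕ) (σ : State) : Prop where
  domino : IsDomino n σ.left σ.right
  order : σ.items.Pairwise Above
  free : ∀ c, .pt c ∈ σ.items → ∀ a b, [a, b].Sublist σ.left → a < c → c < b → False
  ne_nil : ∀ S, .seg S ∈ σ.items → S ≠ []

theorem IsDomino.lt {n : ℕ} {l r : List ℕ} (h : IsDomino n l r) {x : ℕ} (hx : x ∈ l ++ r) :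
    x < n := by
  simpa using h.perm.subset hx

theorem IsDomino.insert_left {n : ℕ} {X Y r : List ℕ} (h : IsDomino n (X ++ Y) r)
    (hXY : ∀ x ∈ X, ∀ y ∈ Y, y < x) : IsDomino (n + 1) (X ++ n :: Y) r := by
  have hX : Avoids132 X := fun a b c hs => h.avoids132 a b c (hs.trans (by simp))
  refine ⟨?_, h.avoids132.insert_max (fun x hx => h.lt (by simp at hx ⊢; tauto)) hXY,
    h.avoids213, ?_⟩
  · rw [List.range_succ, List.append_assoc, List.cons_append]
    refine List.perm_middle.trans ?_
    rw [← List.append_assoc]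
    exact (h.perm.cons n).trans (List.perm_append_singleton _ _).symm
  · rw [List.append_assoc, List.cons_append]
    have h1 := h.avoids1324
    rw [List.append_assoc] at h1
    exact h1.insert_max (fun x hx => h.lt (by simp at hx ⊢; tauto)) hX

/-- A 132 in front of `n` is split between `l` and the increasing `X`. With at most one entry in `l`
it contradicts monotonicity of `X`, with two the freeness of the third, with three the 132-avoidance
of `l`. -/
theorem IsDomino.insert_right {n : ℕ} {l X Y : List ℕ} (h : IsDomino n l (X ++ Y))
    (hX : X.Pairwise (· < ·))
    (hl : ∀ c ∈ X, ∀ a b, [a, b].Sublist l → a < c → c < b → False) :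
    IsDomino (n + 1) l (X ++ n :: Y) := by
  refine ⟨?_, h.avoids132, h.avoids213.insert_max (fun x hx => h.lt (by simp at hx ⊢; tauto)) hX,
    ?_⟩
  · rw [List.range_succ, ← List.append_assoc]
    refine List.perm_middle.trans ?_
    rw [List.append_assoc]
    exact (h.perm.cons n).trans (List.perm_append_singleton _ _).symm
  · rw [← List.append_assoc]
    have h1 := h.avoids1324
    rw [← List.append_assoc] at h1
    refine h1.insert_max (fun x hx => h.lt (by simp at hx ⊢; tauto)) ?_
    intro a b c hs hab hbc
    obtain ⟨s, t, e, hs1, hs2⟩ := List.sublist_append_iff.1 hs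
    have ht : t.Pairwise (· < ·) := hX.sublist hs2
    rcases s with _ | ⟨a', _ | ⟨c', _ | ⟨b', _ | ⟨d', s⟩⟩⟩⟩
    · simp only [List.nil_append] at e
      subst e
      simp at ht; omega
    · simp only [List.cons_append, List.nil_append, List.cons.injEq] at e
      obtain ⟨rfl, rfl⟩ := e
      simp at ht; omega
    · simp only [List.cons_append, List.nil_append, List.cons.injEq] at e
      obtain ⟨rfl, rfl, rfl⟩ := e
      exact hl b (hs2.subset (by simp)) a c hs1 hab hbc
    · simp only [List.cons_append, List.nil_append, List.cons.injEq] at e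
      obtain ⟨rfl, rfl, rfl, rfl⟩ := e
      exact h.avoids132 a b c hs1 hab hbc
    · simp at e

theorem free_insert {X Y : List ℕ} {n c : ℕ} (hn : ∀ x ∈ X ++ Y, x < n) (hcn : c < n)
    (hX : ∀ x ∈ X, c < x)
    (hc : ∀ a b, [a, b].Sublist (X ++ Y) → a < c → c < b → False) :
    ∀ a b, [a, b].Sublist (X ++ n :: Y) → a < c → c < b → False := by
  intro a b hs hac hcb
  have hX' : n ∉ X := fun e => absurd (hn n (by simp [e])) (lt_irrefl _)
  have hY' : n ∉ Y := fun e => absurd (hn n (by simp [e])) (lt_irrefl _)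
  by_cases hb : b = n
  · subst hb
    obtain ⟨h1, -⟩ := sublist_split_insert (s := [a]) (t := []) hX' hY' hs
    exact absurd (hX a (h1.subset (by simp))) (by omega)
  · exact hc a b (sublist_of_sublist_insert hs (by simp; omega)) hac hcb

/-- In the left cell `n` is put first or right after a skew component, so everything before it
exceeds everything after it. It fuses the components before it into one, and the points stacked
above the touched component are retired, since a smaller left entry may now precede `n`. In the
right cell `n` follows a prefix of the stacked run, and the run points behind it are retired. -/
theorem good_children {n : ℕ} {σ τ : State} (h : σ.Good n) (hτ : τ ∈ children n σ) :
    τ.Good (n + 1) := by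
  have hseg : ∀ S, .seg S ∈ σ.items → ∀ x ∈ S, x < n := fun S hS x hx =>
    h.domino.lt (List.mem_append_left _ (mem_segs.2 ⟨S, hS, hx⟩))
  have hpt : ∀ c, .pt c ∈ σ.items → c < n := fun c hc =>
    h.domino.lt (List.mem_append_right _ (List.mem_append_left _ (mem_pts.2 hc)))
  have hleft : ∀ x ∈ σ.left, x < n := fun x hx => h.domino.lt (List.mem_append_left _ hx)
  simp only [children, List.mem_cons, List.mem_append, List.mem_map] at hτ
  rcases hτ with rfl | hτ | ⟨ρ, hρ, rfl⟩
  · refine ⟨?_, ?_, ?_, ?_⟩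
    · exact IsDomino.insert_left (X := []) h.domino (by simp)
    · rw [List.pairwise_cons]
      refine ⟨?_, h.order⟩
      intro i hi
      cases i with
      | seg S => simpa [Above] using hseg S hi
      | pt c => simpa [Above] using hpt c hi
    · intro c hc
      have hc' : .pt c ∈ σ.items := by simpa using hc
      exact free_insert (X := []) (Y := σ.left) hleft (hpt c hc') (by simp) (h.free c hc')
    · intro S hS
      rcases List.mem_cons.1 hS with hS | hS
      · simp only [Item.seg.injEq] at hS; simp [hS]
      · exact h.ne_nil S hS
  · obtain ⟨v, S, w, hvw, rfl⟩ := exists_of_mem_touches hτ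
    have hL : σ.left = (segs v ++ S) ++ segs w := by
      simp [State.left, hvw, segs_append, segs]
    have hR : σ.right = pts w ++ (pts v ++ σ.rest) := by
      simp [State.right, hvw, pts_append, pts]
    have ho := h.order
    rw [hvw, List.pairwise_append, List.pairwise_cons] at ho
    obtain ⟨-, ⟨ho1, ho2⟩, ho3⟩ := ho
    have habove : ∀ x ∈ segs v ++ S, ∀ i ∈ w, Above (.seg [x]) i := by
      intro x hx i hi
      rcases List.mem_append.1 hx with hx | hx
      · obtain ⟨S', hS', hx'⟩ := mem_segs.1 hx
        have := ho3 _ hS' i (List.mem_cons_of_mem _ hi)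
        cases i <;> simp only [Above, List.mem_singleton, forall_eq] at this ⊢ <;>
          exact this x hx'
      · have := ho1 i hi
        cases i <;> simp only [Above, List.mem_singleton, forall_eq] at this ⊢ <;>
          exact this x hx
    have hw : ∀ i ∈ w, i ∈ σ.items := fun i hi => by simp [hvw, hi]
    refine ⟨?_, ?_, ?_, ?_⟩
    · have := h.domino
      rw [hL, hR] at this
      have := this.insert_left (by
        intro x hx y hy
        obtain ⟨S', hS', hy'⟩ := mem_segs.1 hy
        have := habove x hx _ hS'
        simp only [Above, List.mem_singleton, forall_eq] at this
        exact this y hy')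
      simpa [State.left, State.right, segs, pts] using this
    · rw [List.pairwise_cons]
      refine ⟨?_, ho2⟩
      intro i hi
      cases i with
      | seg S' =>
        intro s hs s' hs'
        simp only [List.nil_append, List.mem_append, List.mem_singleton] at hs
        rcases hs with hs | rfl
        · have := habove s (by simpa using hs) _ hi
          simp only [Above, List.mem_singleton, forall_eq] at this
          exact this s' hs'
        · exact hseg S' (hw _ hi) s' hs'
      | pt c =>
        intro s hs
        simp only [List.nil_append, List.mem_append, List.mem_singleton] at hs
        rcases hs with hs | rfl
        · have := habove s (by simpa using hs) _ hi
          simpa only [Above, List.mem_singleton, forall_eq] using this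
        · exact hpt c (hw _ hi)
    · intro c hc
      have hc' : .pt c ∈ w := by simpa using hc
      have := free_insert (X := segs v ++ S) (Y := segs w) (n := n) (c := c)
        (by rw [← hL]; exact hleft) (hpt c (hw _ hc')) (by
          intro x hx
          have := habove x hx _ hc'
          simpa only [Above, List.mem_singleton, forall_eq] using this)
        (by rw [← hL]; exact h.free c (hw _ hc'))
      simpa [State.left, segs] using this
    · intro S' hS'
      rcases List.mem_cons.1 hS' with hS' | hS'
      · simp only [Item.seg.injEq] at hS'; simp [hS']
      · exact h.ne_nil S' (hw _ hS')
  · obtain ⟨t, h1, h2, h3, h4⟩ := exists_of_mem_dels hρ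
    have hR : σ.right = pts ρ.items ++ ρ.rest := by
      simp [State.right, h1, h2]
    have ho := h.order.sublist h4
    refine ⟨?_, ?_, ?_, ?_⟩
    · have := h.domino
      rw [hR] at this
      have := this.insert_right (pairwise_pts ho)
        fun c hc => h.free c (h4.subset (mem_pts.1 hc))
      simpa [State.left, State.right, segs, pts, h3] using this
    · rw [List.pairwise_cons]
      refine ⟨?_, ho⟩
      intro i hi
      cases i with
      | seg S => trivial
      | pt c => exact hpt c (h4.subset hi)
    · intro c hc a b hs hac hcb
      have hs' : [a, b].Sublist σ.left := by simpa [State.left, segs, h3] using hs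
      rcases List.mem_cons.1 hc with hc | hc
      · simp only [Item.pt.injEq] at hc
        have := hleft b (hs'.subset (by simp))
        omega
      · exact h.free c (h4.subset hc) a b hs' hac hcb
    · intro S hS
      exact h.ne_nil S (h4.subset (by simpa using hS))

theorem good_states {n : ℕ} {σ : State} (h : σ ∈ states n) : σ.Good n := by
  induction n generalizing σ with
  | zero =>
    simp only [states, List.mem_singleton] at h
    subst h
    refine ⟨⟨by simp [State.left, State.right, segs, pts], ?_, ?_, ?_⟩, by simp, by simp, by simp⟩
    all_goals
      intro _ _ _
      simp [State.left, State.right, segs, pts]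
  | succ n ih =>
    obtain ⟨τ, hτ, h⟩ := List.mem_flatMap.1 h
    exact good_children (ih hτ) h

/-! ### The generated dominoes are distinct -/

/-- The two cells of a partially built domino. -/
def State.cells (σ : State) : List ℕ × List ℕ := (σ.left, σ.right)

/-- The position of `n` in the left cell tells these children apart. It moves strictly because
components are nonempty, the reason for the invariant `ne_nil`. -/
theorem pairwise_touches {n : ℕ} (u : List Item) (acc rest : List ℕ) (hacc : n ∉ acc)
    (hu : n ∉ segs u) (hne : ∀ S, .seg S ∈ u → S ≠ []) :
    (∀ σ ∈ touches n acc rest u, acc.length < σ.left.idxOf n) ∧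
      (touches n acc rest u).Pairwise fun σ τ => σ.left.idxOf n < τ.left.idxOf n := by
  induction u generalizing acc rest with
  | nil => simp [touches]
  | cons i u ih =>
    cases i with
    | seg S =>
      have hS : n ∉ S := fun e => hu (by simp [segs, e])
      have h1 : n ∉ acc ++ S := by simp [hacc, hS]
      have hlen : 0 < S.length := List.length_pos_iff.2 (hne S (by simp))
      obtain ⟨ih1, ih2⟩ := ih (acc ++ S) rest h1 (fun e => hu (by simp [segs, e]))
        (fun S' hS' => hne S' (by simp [hS']))
      have h3 : (State.mk (.seg (acc ++ S ++ [n]) :: u) rest).left.idxOf n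
          = (acc ++ S).length := by
        simp only [State.left, segs]
        rw [List.append_assoc, List.idxOf_append_of_notMem h1]
        simp
      rw [List.length_append] at h3 ih1
      refine ⟨?_, ?_⟩
      · intro σ hσ
        rcases List.mem_cons.1 hσ with rfl | hσ
        · omega
        · have := ih1 σ hσ; omega
      · rw [touches, List.pairwise_cons]
        exact ⟨fun σ hσ => by have := ih1 σ hσ; omega, ih2⟩
    | pt c =>
      exact ih acc (c :: rest) hacc hu (fun S' hS' => hne S' (by simp [hS']))

theorem pairwise_dels (u : List Item) (rest : List ℕ) :
    (∀ σ ∈ dels rest u, (pts σ.items).length ≤ (pts u).length) ∧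
      (dels rest u).Pairwise fun σ τ => (pts τ.items).length < (pts σ.items).length := by
  induction u generalizing rest with
  | nil => simp [dels]
  | cons i u ih =>
    cases i with
    | seg S =>
      obtain ⟨ih1, ih2⟩ := ih rest
      refine ⟨?_, ?_⟩
      · intro σ hσ
        obtain ⟨τ, hτ, rfl⟩ := List.mem_map.1 hσ
        exact ih1 τ hτ
      · rw [dels, List.pairwise_map]
        exact ih2
    | pt c =>
      obtain ⟨ih1, ih2⟩ := ih (c :: rest)
      refine ⟨?_, ?_⟩
      · intro σ hσ
        rcases List.mem_cons.1 hσ with rfl | hσ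
        · rfl
        · have := ih1 σ hσ; simp [pts]; omega
      · rw [dels, List.pairwise_cons]
        exact ⟨fun σ hσ => by have := ih1 σ hσ; simp [pts]; omega, ih2⟩

theorem filter_lt_insert {n : ℕ} {X Y : List ℕ} (h : ∀ x ∈ X ++ Y, x < n) :
    (X ++ n :: Y).filter (fun x => decide (x < n)) = X ++ Y := by
  have h1 : X.filter (fun x => decide (x < n)) = X :=
    List.filter_eq_self.2 fun x hx => by simpa using h x (by simp [hx])
  have h2 : Y.filter (fun x => decide (x < n)) = Y :=
    List.filter_eq_self.2 fun x hx => by simpa using h x (by simp [hx])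
  simp [h1, h2]

/-- Removing the maximum recovers the cells of the parent, so children of different parents differ.
-/
theorem filter_cells_children {n : ℕ} {σ τ : State} (h : σ.Good n) (hτ : τ ∈ children n σ) :
    (τ.left.filter (fun x => decide (x < n)), τ.right.filter (fun x => decide (x < n)))
      = σ.cells := by
  have hleft : ∀ x ∈ σ.left, x < n := fun x hx => h.domino.lt (List.mem_append_left _ hx)
  have hright : ∀ x ∈ σ.right, x < n := fun x hx => h.domino.lt (List.mem_append_right _ hx)
  have hl : σ.left.filter (fun x => decide (x < n)) = σ.left :=
    List.filter_eq_self.2 fun x hx => by simpa using hleft x hx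
  have hr : σ.right.filter (fun x => decide (x < n)) = σ.right :=
    List.filter_eq_self.2 fun x hx => by simpa using hright x hx
  simp only [children, List.mem_cons, List.mem_append, List.mem_map] at hτ
  rw [State.cells, Prod.mk.injEq]
  rcases hτ with rfl | hτ | ⟨ρ, hρ, rfl⟩
  · exact ⟨filter_lt_insert (X := []) hleft, hr⟩
  · obtain ⟨v, S, w, hvw, rfl⟩ := exists_of_mem_touches hτ
    have hL : σ.left = (segs v ++ S) ++ segs w := by
      simp [State.left, hvw, segs_append, segs]
    have hR : σ.right = pts w ++ (pts v ++ σ.rest) := by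
      simp [State.right, hvw, pts_append, pts]
    rw [hL] at hleft
    have := filter_lt_insert hleft
    refine ⟨?_, ?_⟩
    · rw [hL, ← this]; simp [State.left, segs]
    · rw [hR] at hr ⊢; exact hr
  · obtain ⟨t, h1, h2, h3, h4⟩ := exists_of_mem_dels hρ
    have hR : σ.right = pts ρ.items ++ ρ.rest := by
      simp [State.right, h1, h2]
    rw [hR] at hright
    have := filter_lt_insert hright
    refine ⟨?_, ?_⟩
    · simpa [State.left, segs, h3] using hl
    · rw [hR, ← this]; simp [State.right, pts]

theorem nodup_cells_children {n : ℕ} {σ : State} (h : σ.Good n) :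
    ((children n σ).map State.cells).Nodup := by
  have hl : n ∉ σ.left := fun e => absurd (h.domino.lt (List.mem_append_left _ e)) (lt_irrefl _)
  have hr : n ∉ σ.right := fun e => absurd (h.domino.lt (List.mem_append_right _ e)) (lt_irrefl _)
  obtain ⟨ht1, ht2⟩ := pairwise_touches (n := n) σ.items [] σ.rest (by simp) hl h.ne_nil
  have hd2 := (pairwise_dels σ.items σ.rest).2
  have hmem : ∀ τ ∈ touches n [] σ.rest σ.items, n ∈ τ.left := by
    intro τ hτ
    obtain ⟨v, S, w, -, rfl⟩ := exists_of_mem_touches hτ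
    simp [State.left, segs]
  have hnot : ∀ τ ∈ (dels σ.rest σ.items).map (fun τ => State.mk (.pt n :: τ.items) τ.rest),
      n ∉ τ.left := by
    intro τ hτ
    obtain ⟨ρ, hρ, rfl⟩ := List.mem_map.1 hτ
    obtain ⟨t, -, -, h3, -⟩ := exists_of_mem_dels hρ
    simpa [State.left, segs, h3] using hl
  rw [children, List.Nodup, List.pairwise_map, List.pairwise_cons, List.pairwise_append]
  refine ⟨?_, ht2.imp ?_, ?_, ?_⟩
  · intro τ hτ e
    have e1 : n :: σ.left = τ.left := congrArg Prod.fst e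
    rcases List.mem_append.1 hτ with hτ | hτ
    · have := ht1 τ hτ
      rw [← e1] at this
      simp at this
    · exact hnot τ hτ (by simp [← e1])
  · intro τ ρ hlt e
    have e1 : τ.left = ρ.left := congrArg Prod.fst e
    rw [e1] at hlt
    exact lt_irrefl _ hlt
  · rw [List.pairwise_map]
    refine (List.Pairwise.and_mem.1 hd2).imp ?_
    rintro τ ρ ⟨hτ, hρ, hlt⟩ e
    have e1 : State.right ⟨.pt n :: τ.items, τ.rest⟩ = State.right ⟨.pt n :: ρ.items, ρ.rest⟩ :=
      congrArg Prod.snd e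
    have key : ∀ τ ∈ dels σ.rest σ.items,
        (State.right ⟨.pt n :: τ.items, τ.rest⟩).idxOf n = (pts τ.items).length := by
      intro τ hτ
      obtain ⟨t, h1, -, -, -⟩ := exists_of_mem_dels hτ
      have : n ∉ pts τ.items := fun e => hr (by simp [State.right, h1, e])
      simp only [State.right, pts]
      rw [List.append_assoc, List.idxOf_append_of_notMem this]
      simp
    have k1 := key τ hτ
    rw [e1, key ρ hρ] at k1
    omega
  · intro τ hτ ρ hρ e
    have e1 : τ.left = ρ.left := congrArg Prod.fst e
    exact hnot ρ hρ (e1 ▸ hmem τ hτ)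

theorem nodup_cells_states (n : ℕ) : ((states n).map State.cells).Nodup := by
  induction n with
  | zero => simp [states]
  | succ n ih =>
    rw [states, List.map_flatMap, List.nodup_flatMap]
    refine ⟨fun σ hσ => nodup_cells_children (good_states hσ), ?_⟩
    rw [List.Nodup, List.pairwise_map] at ih
    refine (List.Pairwise.and_mem.1 ih).imp ?_
    rintro σ τ ⟨hσ, hτ, hne⟩
    intro p hp hp'
    obtain ⟨σ', hσ', rfl⟩ := List.mem_map.1 hp
    obtain ⟨τ', hτ', e⟩ := List.mem_map.1 hp'
    refine hne ?_
    rw [← filter_cells_children (good_states hσ) hσ', ← filter_cells_children (good_states hτ) hτ']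
    have e1 : τ'.left = σ'.left := congrArg Prod.fst e
    have e2 : τ'.right = σ'.right := congrArg Prod.snd e
    rw [e1, e2]

/-- Many dominoes with `n` points have the same number of points in the left cell. -/
theorem exists_finset_isDomino (n : ℕ) : ∃ m₁ m₂ : ℕ, m₁ + m₂ = n ∧
    ∃ F : Finset (List ℕ × List ℕ), dominoCount n ≤ (n + 1) * F.card ∧
      ∀ p ∈ F, IsDomino n p.1 p.2 ∧ p.1.length = m₁ ∧ p.2.length = m₂ := by
  classical
  set F := ((states n).map State.cells).toFinset with hF
  have hcard : F.card = dominoCount n := by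
    rw [hF, List.toFinset_card_of_nodup (nodup_cells_states n), List.length_map, length_states]
  have hdom : ∀ p ∈ F, IsDomino n p.1 p.2 := by
    intro p hp
    rw [hF, List.mem_toFinset, List.mem_map] at hp
    obtain ⟨σ, hσ, rfl⟩ := hp
    exact (good_states hσ).domino
  have hlen : ∀ p ∈ F, p.1.length + p.2.length = n := by
    intro p hp
    simpa using (hdom p hp).perm.length_eq
  have hsum := Finset.card_eq_sum_card_fiberwise (f := fun p : List ℕ × List ℕ => p.1.length)
    (s := F) (t := Finset.range (n + 1)) (by
      intro p hp
      have := hlen p hp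
      simp; omega)
  -- By pigeonhole the most frequent left length loses only a factor `n + 1`.
  obtain ⟨m, hm, hmax⟩ := Finset.exists_max_image (Finset.range (n + 1))
    (fun b => (F.filter fun p => p.1.length = b).card) (by simp)
  refine ⟨m, n - m, by simp at hm; omega, F.filter fun p => p.1.length = m, ?_, ?_⟩
  · rw [← hcard, hsum]
    have := Finset.sum_le_card_nsmul (Finset.range (n + 1))
      (fun b => (F.filter fun p => p.1.length = b).card) _ hmax
    simpa using this
  · intro p hp
    rw [Finset.mem_filter] at hp
    have := hlen p hp.1
    exact ⟨hdom p hp.1, hp.2, by omega⟩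

/-! ### Interleavings and blocks -/

/-- All the interleavings of two lists. -/
def shuffles : List ℕ → List ℕ → List (List ℕ)
  | [], ys => [ys]
  | x :: xs, [] => [x :: xs]
  | x :: xs, y :: ys =>
      (shuffles xs (y :: ys)).map (x :: ·) ++ (shuffles (x :: xs) ys).map (y :: ·)
termination_by xs ys => xs.length + ys.length

theorem length_shuffles (xs ys : List ℕ) :
    (shuffles xs ys).length = (xs.length + ys.length).choose xs.length := by
  induction xs, ys using shuffles.induct with
  | case1 ys => simp [shuffles]
  | case2 x xs => simp [shuffles]
  | case3 x xs y ys ih1 ih2 =>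
    simp only [shuffles, List.length_append, List.length_map, ih1, ih2, List.length_cons]
    rw [show xs.length + 1 + (ys.length + 1) = (xs.length + (ys.length + 1)) + 1 by omega,
      Nat.choose_succ_succ, show xs.length + 1 + ys.length = xs.length + (ys.length + 1) by omega]

theorem nodup_shuffles (xs ys : List ℕ) (h : ∀ x ∈ xs, ∀ y ∈ ys, x ≠ y) :
    (shuffles xs ys).Nodup := by
  induction xs, ys using shuffles.induct with
  | case1 ys => simp [shuffles]
  | case2 x xs => simp [shuffles]
  | case3 x xs y ys ih1 ih2 =>
    rw [shuffles, List.nodup_append]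
    refine ⟨(ih1 fun a ha b hb => h a (by simp [ha]) b hb).map (List.cons_injective),
      (ih2 fun a ha b hb => h a ha b (by simp [hb])).map (List.cons_injective), ?_⟩
    intro a ha b hb e
    obtain ⟨a', -, rfl⟩ := List.mem_map.1 ha
    obtain ⟨b', -, rfl⟩ := List.mem_map.1 hb
    simp only [List.cons.injEq] at e
    exact h x (by simp) y (by simp) e.1

theorem perm_of_mem_shuffles {xs ys s : List ℕ} (hs : s ∈ shuffles xs ys) :
    s.Perm (xs ++ ys) := by
  induction xs, ys using shuffles.induct generalizing s with
  | case1 ys => simp only [shuffles, List.mem_singleton] at hs; simp [hs]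
  | case2 x xs => simp only [shuffles, List.mem_singleton] at hs; simp [hs]
  | case3 x xs y ys ih1 ih2 =>
    rw [shuffles, List.mem_append, List.mem_map, List.mem_map] at hs
    rcases hs with ⟨s, hs, rfl⟩ | ⟨s, hs, rfl⟩
    · exact (ih1 hs).cons x
    · exact ((ih2 hs).cons y).trans List.perm_middle.symm

theorem filter_of_mem_shuffles {xs ys s : List ℕ} (p : ℕ → Bool) (hs : s ∈ shuffles xs ys) :
    (∀ x ∈ xs, p x = true) → (∀ y ∈ ys, p y = false) → s.filter p = xs := by
  induction xs, ys using shuffles.induct generalizing s with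
  | case1 ys =>
    simp only [shuffles, List.mem_singleton] at hs
    intro _ h; subst hs
    simpa using h
  | case2 x xs =>
    simp only [shuffles, List.mem_singleton] at hs
    intro h _; subst hs
    exact List.filter_eq_self.2 h
  | case3 x xs y ys ih1 ih2 =>
    intro h1 h2
    rw [shuffles, List.mem_append, List.mem_map, List.mem_map] at hs
    rcases hs with ⟨s, hs, rfl⟩ | ⟨s, hs, rfl⟩
    · rw [List.filter_cons_of_pos (h1 x (by simp)), ih1 hs (fun a ha => h1 a (by simp [ha])) h2]
    · rw [List.filter_cons_of_neg (by simp [h2 y]), ih2 hs h1 (fun a ha => h2 a (by simp [ha]))]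

theorem filter_of_mem_shuffles' {xs ys s : List ℕ} (p : ℕ → Bool) (hs : s ∈ shuffles xs ys) :
    (∀ x ∈ xs, p x = false) → (∀ y ∈ ys, p y = true) → s.filter p = ys := by
  induction xs, ys using shuffles.induct generalizing s with
  | case1 ys =>
    simp only [shuffles, List.mem_singleton] at hs
    intro _ h; subst hs
    exact List.filter_eq_self.2 h
  | case2 x xs =>
    simp only [shuffles, List.mem_singleton] at hs
    intro h _; subst hs
    simpa using h
  | case3 x xs y ys ih1 ih2 =>
    intro h1 h2
    rw [shuffles, List.mem_append, List.mem_map, List.mem_map] at hs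
    rcases hs with ⟨s, hs, rfl⟩ | ⟨s, hs, rfl⟩
    · rw [List.filter_cons_of_neg (by simp [h1 x]), ih1 hs (fun a ha => h1 a (by simp [ha])) h2]
    · rw [List.filter_cons_of_pos (h2 y (by simp)), ih2 hs h1 (fun a ha => h2 a (by simp [ha]))]

theorem Avoids132.map_add {l : List ℕ} (h : Avoids132 l) (k : ℕ) :
    Avoids132 (l.map (· + k)) := by
  intro a b c hs hab hbc
  obtain ⟨t, ht, e⟩ := List.sublist_map_iff.1 hs
  match t, e with
  | [a', c', b'], e =>
    simp only [List.map_cons, List.map_nil, List.cons.injEq, and_true] at e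
    obtain ⟨rfl, rfl, rfl⟩ := e
    exact h a' b' c' ht (by omega) (by omega)

theorem Avoids213.map_add {l : List ℕ} (h : Avoids213 l) (k : ℕ) :
    Avoids213 (l.map (· + k)) := by
  intro a b c hs hab hbc
  obtain ⟨t, ht, e⟩ := List.sublist_map_iff.1 hs
  match t, e with
  | [b', a', c'], e =>
    simp only [List.map_cons, List.map_nil, List.cons.injEq, and_true] at e
    obtain ⟨rfl, rfl, rfl⟩ := e
    exact h a' b' c' ht (by omega) (by omega)

theorem Avoids1324.map_add {l : List ℕ} (h : Avoids1324 l) (k : ℕ) :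
    Avoids1324 (l.map (· + k)) := by
  intro a b c d hs hab hbc hcd
  obtain ⟨t, ht, e⟩ := List.sublist_map_iff.1 hs
  match t, e with
  | [a', c', b', d'], e =>
    simp only [List.map_cons, List.map_nil, List.cons.injEq, and_true] at e
    obtain ⟨rfl, rfl, rfl, rfl⟩ := e
    exact h a' b' c' d' ht (by omega) (by omega) (by omega)

/-- The numbers `a, …, a + k - 1` in decreasing order. -/
def descending (a k : ℕ) : List ℕ := (List.range' a k).reverse

theorem mem_descending {a k x : ℕ} : x ∈ descending a k ↔ a ≤ x ∧ x < a + k := by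
  simp [descending, List.mem_range'_1]

theorem pairwise_descending (a k : ℕ) : (descending a k).Pairwise (· > ·) := by
  rw [descending, List.pairwise_reverse]
  exact List.pairwise_lt_range'

/-- One-line notation of a `1324`-avoider of length `T` whose `k₁` largest values are in decreasing
order and whose `k₂` smallest values are in decreasing order. -/
structure IsBlock (T k₁ k₂ : ℕ) (q : List ℕ) : Prop where
  perm : q.Perm (List.range T)
  avoids : Avoids1324 q
  top : (q.filter fun x => decide (T - k₁ ≤ x)).Pairwise (· > ·)
  bottom : (q.filter fun x => decide (x < k₂)).Pairwise (· > ·)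

theorem sublist_filter_of_forall {s t : List ℕ} (p : ℕ → Bool) (h : s.Sublist t)
    (hp : ∀ x ∈ s, p x = true) : s.Sublist (t.filter p) := by
  have := h.filter p
  rwa [List.filter_eq_self.2 hp] at this

theorem sublist_left_of_getLast_notMem {s t u : List ℕ} {d : ℕ} (h : (s ++ [d]).Sublist (t ++ u))
    (hd : d ∉ u) : (s ++ [d]).Sublist t := by
  obtain ⟨v, w, e, hv, hw⟩ := List.sublist_append_iff.1 h
  rcases List.eq_nil_or_concat w with rfl | ⟨w', x, rfl⟩
  · rw [List.append_nil] at e; rwa [e]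
  · rw [List.concat_eq_append] at e hw
    rw [← List.append_assoc] at e
    have : d = x := by simpa using congrArg List.getLast? e
    exact absurd (hw.subset (by simp [this])) hd

theorem sublist_right_of_head_notMem {s t u : List ℕ} {d : ℕ} (h : (d :: s).Sublist (t ++ u))
    (hd : d ∉ t) : (d :: s).Sublist u := by
  obtain ⟨v, w, e, hv, hw⟩ := List.sublist_append_iff.1 h
  rcases v with _ | ⟨x, v⟩
  · rw [List.nil_append] at e; rwa [e]
  · simp only [List.cons_append, List.cons.injEq] at e
    exact absurd (hv.subset (by simp [e.1])) hd

/-- If the 4 of an occurrence is an added large value, the occurrence lies in `s`; then its 3 is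
either added too, against the decreasing order, or completes a 132 in `l`. Dually, an added small 1
forces a 213 in `r` or an ascent among the small values. Otherwise the occurrence lies in the
domino. -/
theorem IsDomino.isBlock {n k₁ k₂ : ℕ} {l r s t : List ℕ} (h : IsDomino n l r)
    (hs : s ∈ shuffles (descending (k₂ + n) k₁) (l.map (· + k₂)))
    (ht : t ∈ shuffles (r.map (· + k₂)) (descending 0 k₂)) :
    IsBlock (k₂ + n + k₁) k₁ k₂ (s ++ t) := by
  have hl : ∀ x ∈ l.map (· + k₂), k₂ ≤ x ∧ x < k₂ + n := by
    intro x hx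
    obtain ⟨y, hy, rfl⟩ := List.mem_map.1 hx
    have := h.lt (List.mem_append_left _ hy); omega
  have hr : ∀ x ∈ r.map (· + k₂), k₂ ≤ x ∧ x < k₂ + n := by
    intro x hx
    obtain ⟨y, hy, rfl⟩ := List.mem_map.1 hx
    have := h.lt (List.mem_append_right _ hy); omega
  have hsm : ∀ x ∈ s, k₂ ≤ x := by
    intro x hx
    rcases List.mem_append.1 ((perm_of_mem_shuffles hs).subset hx) with hx | hx
    · rw [mem_descending] at hx; omega
    · exact (hl x hx).1
  have htm : ∀ x ∈ t, x < k₂ + n := by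
    intro x hx
    rcases List.mem_append.1 ((perm_of_mem_shuffles ht).subset hx) with hx | hx
    · exact (hr x hx).2
    · rw [mem_descending] at hx; omega
  have hs1 : s.filter (fun x => decide (k₂ + n ≤ x)) = descending (k₂ + n) k₁ := by
    refine filter_of_mem_shuffles _ hs ?_ ?_
    · intro x hx; rw [mem_descending] at hx; simpa using hx.1
    · intro x hx; simpa using (hl x hx).2
  have hs2 : s.filter (fun x => decide (x < k₂ + n)) = l.map (· + k₂) := by
    refine filter_of_mem_shuffles' _ hs ?_ ?_
    · intro x hx; rw [mem_descending] at hx; simpa using hx.1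
    · intro x hx; simpa using (hl x hx).2
  have ht1 : t.filter (fun x => decide (k₂ ≤ x)) = r.map (· + k₂) := by
    refine filter_of_mem_shuffles _ ht ?_ ?_
    · intro x hx; simpa using (hr x hx).1
    · intro x hx; rw [mem_descending] at hx; simpa using hx.2
  have ht2 : t.filter (fun x => decide (x < k₂)) = descending 0 k₂ := by
    refine filter_of_mem_shuffles' _ ht ?_ ?_
    · intro x hx; simpa using (hr x hx).1
    · intro x hx; rw [mem_descending] at hx; simpa using hx.2
  have hs3 : s.filter (fun x => decide (x < k₂)) = [] := by
    rw [List.filter_eq_nil_iff]; intro x hx; simpa using hsm x hx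
  have ht3 : t.filter (fun x => decide (k₂ + n ≤ x)) = [] := by
    rw [List.filter_eq_nil_iff]; intro x hx; simpa using htm x hx
  refine ⟨?_, ?_, ?_, ?_⟩
  · have h0 : ((l ++ r).map (· + k₂)).Perm (List.range' k₂ n) := by
      have := h.perm.map (· + k₂)
      refine this.trans (List.Perm.of_eq ?_)
      rw [List.range'_eq_map_range]
      exact List.map_congr_left fun a _ => by simp [add_comm]
    have e : List.range (k₂ + n + k₁)
        = List.range' 0 k₂ ++ List.range' k₂ n ++ List.range' (k₂ + n) k₁ := by
      rw [List.range_eq_range', ← List.range'_append_1, ← List.range'_append_1]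
      simp
    rw [e]
    have d1 : (descending (k₂ + n) k₁).Perm (List.range' (k₂ + n) k₁) := List.reverse_perm _
    have d2 : (descending 0 k₂).Perm (List.range' 0 k₂) := List.reverse_perm _
    rw [List.map_append] at h0
    refine ((perm_of_mem_shuffles hs).append (perm_of_mem_shuffles ht)).trans ?_
    refine List.Perm.trans ?_ ((d2.append h0).append d1)
    rw [List.perm_iff_count]
    intro a
    simp only [List.count_append]
    omega
  · intro a b c d hsub hab hbc hcd
    by_cases hd : k₂ + n ≤ d
    · have h1 : [a, c, b, d].Sublist s :=
        sublist_left_of_getLast_notMem (s := [a, c, b]) hsub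
          (fun hm => absurd (htm d hm) (by omega))
      by_cases hc : k₂ + n ≤ c
      · have h2 : [c, d].Sublist s := List.Sublist.trans (by
          refine List.Sublist.cons _ (List.Sublist.cons_cons _ (List.Sublist.cons _ ?_))
          exact List.Sublist.refl _) h1
        have h3 := sublist_filter_of_forall (fun x => decide (k₂ + n ≤ x)) h2 (by simp [hc, hd])
        rw [hs1] at h3
        have := (pairwise_descending _ _).sublist h3
        simp at this; omega
      · have h2 : [a, c, b].Sublist s :=
          (List.sublist_append_left [a, c, b] [d]).trans h1
        have h3 := sublist_filter_of_forall (fun x => decide (x < k₂ + n)) h2 (by simp; omega)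
        rw [hs2] at h3
        exact h.avoids132.map_add k₂ a b c h3 hab hbc
    · by_cases ha : a < k₂
      · have h1 : [a, c, b, d].Sublist t :=
          sublist_right_of_head_notMem hsub (fun hm => absurd (hsm a hm) (by omega))
        by_cases hb : b < k₂
        · have h2 : [a, b].Sublist t := List.Sublist.trans (by
            refine List.Sublist.cons_cons _ (List.Sublist.cons _ (List.Sublist.cons_cons _ ?_))
            exact List.nil_sublist _) h1
          have h3 := sublist_filter_of_forall (fun x => decide (x < k₂)) h2 (by simp [ha, hb])
          rw [ht2] at h3
          have := (pairwise_descending _ _).sublist h3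
          simp at this; omega
        · have h2 : [c, b, d].Sublist t := (List.sublist_cons_self _ _).trans h1
          have h3 := sublist_filter_of_forall (fun x => decide (k₂ ≤ x)) h2 (by simp; omega)
          rw [ht1] at h3
          exact h.avoids213.map_add k₂ b c d h3 hbc hcd
      · have h1 := sublist_filter_of_forall (fun x => decide (x < k₂ + n)) hsub (by simp; omega)
        rw [List.filter_append, hs2] at h1
        have h2 := sublist_filter_of_forall (fun x => decide (k₂ ≤ x)) h1 (by simp; omega)
        rw [List.filter_append, List.filter_eq_self.2 (by simp)] at h2
        have h3 : ((t.filter fun x => decide (x < k₂ + n)).filter fun x => decide (k₂ ≤ x))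
            = r.map (· + k₂) := by
          have : t.filter (fun x => decide (x < k₂ + n)) = t :=
            List.filter_eq_self.2 fun x hx => by simpa using htm x hx
          rw [this, ht1]
        rw [h3, ← List.map_append] at h2
        exact h.avoids1324.map_add k₂ a b c d h2 hab hbc hcd
  · rw [Nat.add_sub_cancel, List.filter_append, hs1, ht3, List.append_nil]
    exact pairwise_descending _ _
  · rw [List.filter_append, hs3, ht2, List.nil_append]
    exact pairwise_descending _ _

theorem exists_finset_isBlock {n m₁ m₂ : ℕ} (k₁ k₂ : ℕ) (F : Finset (List ℕ × List ℕ))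
    (hF : ∀ p ∈ F, IsDomino n p.1 p.2 ∧ p.1.length = m₁ ∧ p.2.length = m₂) :
    ∃ G : Finset (List ℕ), G.card = F.card * ((k₁ + m₁).choose k₁ * (m₂ + k₂).choose m₂) ∧
      ∀ q ∈ G, IsBlock (k₂ + n + k₁) k₁ k₂ q := by
  classical
  let U : List ℕ × List ℕ → Finset (List ℕ × List ℕ) := fun p =>
    (shuffles (descending (k₂ + n) k₁) (p.1.map (· + k₂))).toFinset ×ˢ
      (shuffles (p.2.map (· + k₂)) (descending 0 k₂)).toFinset
  have hU : ∀ p ∈ F, (U p).card = (k₁ + m₁).choose k₁ * (m₂ + k₂).choose m₂ := by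
    intro p hp
    obtain ⟨h, h1, h2⟩ := hF p hp
    rw [Finset.card_product, List.toFinset_card_of_nodup, List.toFinset_card_of_nodup,
      length_shuffles, length_shuffles]
    · simp [descending, h1, h2]
    · refine nodup_shuffles _ _ ?_
      intro x hx y hy
      obtain ⟨z, hz, rfl⟩ := List.mem_map.1 hx
      rw [mem_descending] at hy; omega
    · refine nodup_shuffles _ _ ?_
      intro x hx y hy
      obtain ⟨z, hz, rfl⟩ := List.mem_map.1 hy
      have := h.lt (List.mem_append_left _ hz)
      rw [mem_descending] at hx; omega
  refine ⟨(F.sigma U).image fun x => x.2.1 ++ x.2.2, ?_, ?_⟩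
  · rw [Finset.card_image_of_injOn, Finset.card_sigma, Finset.sum_congr rfl hU, Finset.sum_const,
      smul_eq_mul]
    rintro ⟨p, s, t⟩ hx ⟨p', s', t'⟩ hx' e
    simp only [Finset.coe_sigma, Set.mem_sigma_iff, Finset.mem_coe, U, Finset.mem_product,
      List.mem_toFinset] at hx hx'
    simp only at e
    obtain ⟨hp, hs, ht⟩ := hx
    obtain ⟨hp', hs', ht'⟩ := hx'
    -- The common cell lengths fix where a block is to be cut; filtering by value then recovers the
    -- domino.
    have hlen : s.length = s'.length := by
      rw [(perm_of_mem_shuffles hs).length_eq, (perm_of_mem_shuffles hs').length_eq]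
      simp [(hF p hp).2.1, (hF p' hp').2.1]
    obtain ⟨rfl, rfl⟩ := List.append_inj e hlen
    have inj : Function.Injective (· + k₂ : ℕ → ℕ) := fun a b h => by simpa using h
    have key : ∀ p ∈ F, s ∈ shuffles (descending (k₂ + n) k₁) (p.1.map (· + k₂)) →
        t ∈ shuffles (p.2.map (· + k₂)) (descending 0 k₂) →
        s.filter (fun x => decide (x < k₂ + n)) = p.1.map (· + k₂) ∧
        t.filter (fun x => decide (k₂ ≤ x)) = p.2.map (· + k₂) := by
      intro p hp hs ht
      refine ⟨filter_of_mem_shuffles' _ hs ?_ ?_, filter_of_mem_shuffles _ ht ?_ ?_⟩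
      · intro x hx; rw [mem_descending] at hx; simpa using hx.1
      · intro x hx
        obtain ⟨z, hz, rfl⟩ := List.mem_map.1 hx
        have := (hF p hp).1.lt (List.mem_append_left _ hz)
        simp; omega
      · intro x hx
        obtain ⟨z, hz, rfl⟩ := List.mem_map.1 hx
        simp
      · intro x hx; rw [mem_descending] at hx; simpa using hx.2
    have k1 := key p hp hs ht
    have k2 := key p' hp' hs' ht'
    have e1 : p.1 = p'.1 := List.map_injective_iff.2 inj (k1.1.symm.trans k2.1)
    have e2 : p.2 = p'.2 := List.map_injective_iff.2 inj (k1.2.symm.trans k2.2)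
    obtain rfl : p = p' := Prod.ext e1 e2
    rfl
  · intro q hq
    obtain ⟨⟨p, s, t⟩, hx, rfl⟩ := Finset.mem_image.1 hq
    simp only [Finset.mem_sigma, U, Finset.mem_product, List.mem_toFinset] at hx
    exact (hF p hx.1).1.isBlock hx.2.1 hx.2.2

/-! ### Permutations with monotone margins and their symmetries -/

/-- A permutation of `Fin n` as a function on the natural numbers. -/
def toNat {n : ℕ} (π : Equiv.Perm (Fin n)) (i : ℕ) : ℕ := if h : i < n then π ⟨i, h⟩ else i

theorem toNat_val {n : ℕ} (π : Equiv.Perm (Fin n)) (i : Fin n) : toNat π i = π i := by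
  simp [toNat]

theorem toNat_lt {n : ℕ} (π : Equiv.Perm (Fin n)) {i : ℕ} (hi : i < n) : toNat π i < n := by
  simp [toNat, hi]

theorem toNat_inj {n : ℕ} (π : Equiv.Perm (Fin n)) {i j : ℕ} (hi : i < n) (hj : j < n)
    (h : toNat π i = toNat π j) : i = j := by
  simp only [toNat, hi, hj, dite_true] at h
  simpa using π.injective (Fin.ext h)

theorem toNat_symm {n : ℕ} (π : Equiv.Perm (Fin n)) (i : ℕ) : toNat π (toNat π.symm i) = i := by
  by_cases hi : i < n <;> simp [toNat, hi]

theorem toNat_symm' {n : ℕ} (π : Equiv.Perm (Fin n)) (i : ℕ) : toNat π.symm (toNat π i) = i := by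
  simpa using toNat_symm π.symm i

theorem ext_toNat {n : ℕ} {π ρ : Equiv.Perm (Fin n)}
    (h : ∀ i < n, toNat π i = toNat ρ i) : π = ρ := by
  ext i
  simpa [toNat_val] using h i i.2

theorem exists_perm_toNat {n : ℕ} (f : ℕ → ℕ) (hf : ∀ i < n, f i < n)
    (hinj : ∀ i < n, ∀ j < n, f i = f j → i = j) :
    ∃ π : Equiv.Perm (Fin n), ∀ i < n, toNat π i = f i := by
  let g : Fin n → Fin n := fun i => ⟨f i, hf i i.2⟩
  have hg : Function.Injective g := by
    intro i j h
    exact Fin.ext (hinj i i.2 j j.2 (by simpa [g] using h))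
  refine ⟨Equiv.ofBijective g (Finite.injective_iff_bijective.1 hg), ?_⟩
  intro i hi
  simp [toNat, hi, g]

/-- The only order automorphism of `Fin n` is the identity. -/
theorem eq_of_toNat_lt_iff {n : ℕ} {π ρ : Equiv.Perm (Fin n)}
    (h : ∀ i < n, ∀ j < n, toNat π i < toNat π j ↔ toNat ρ i < toNat ρ j) : π = ρ := by
  have h' : ∀ i j : Fin n, π i < π j ↔ ρ i < ρ j := by
    intro i j
    have := h i i.2 j j.2
    rwa [toNat_val, toNat_val, toNat_val, toNat_val, Fin.val_fin_lt, Fin.val_fin_lt] at this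
  let e : Fin n ≃o Fin n :=
    StrictMono.orderIsoOfSurjective (fun i => ρ (π.symm i))
      (fun i j hij => (h' _ _).1 (by simpa using hij))
      (fun i => ⟨π (ρ.symm i), by simp⟩)
  have he : e = OrderIso.refl (Fin n) := Subsingleton.elim _ _
  ext i
  have h1 : e (π i) = π i := by rw [he]; rfl
  have h2 : e (π i) = ρ (π.symm (π i)) := rfl
  rw [← h1, h2, Equiv.symm_apply_apply]

/-- `π` avoids `1324`. -/
def PermAvoids {n : ℕ} (π : Equiv.Perm (Fin n)) : Prop :=
  ∀ i j k l, i < j → j < k → k < l → l < n → toNat π i < toNat π k → toNat π k < toNat π j →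
    toNat π j < toNat π l → False

theorem PermAvoids.not_containsPattern {n : ℕ} {π : Equiv.Perm (Fin n)} (h : PermAvoids π) :
    ¬ ContainsPattern π pattern1324 := by
  rintro ⟨f, hf, hp⟩
  refine h (f 0) (f 1) (f 2) (f 3) (hf (by decide)) (hf (by decide)) (hf (by decide)) (f 3).2
    ?_ ?_ ?_
  · simpa [toNat_val] using (hp 0 2).2 (by decide)
  · simpa [toNat_val] using (hp 2 1).2 (by decide)
  · simpa [toNat_val] using (hp 1 3).2 (by decide)

theorem PermAvoids.symm {n : ℕ} {π : Equiv.Perm (Fin n)} (h : PermAvoids π) :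
    PermAvoids π.symm := by
  intro i j k l hij hjk hkl hl h1 h2 h3
  have := toNat_lt π.symm hl
  refine h (toNat π.symm i) (toNat π.symm k) (toNat π.symm j) (toNat π.symm l) h1 h2 h3 this
    ?_ ?_ ?_ <;> simp only [toNat_symm] <;> assumption

/-- The `k` smallest values of `π` are in decreasing order. -/
def BottomDecreasing {n : ℕ} (π : Equiv.Perm (Fin n)) (k : ℕ) : Prop :=
  ∀ i j, i < j → j < n → toNat π i < k → toNat π j < k → toNat π j < toNat π i

/-- The `k` largest values of `π` are in decreasing order. -/
def TopDecreasing {n : ℕ} (π : Equiv.Perm (Fin n)) (k : ℕ) : Prop :=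
  ∀ i j, i < j → j < n → n ≤ toNat π i + k → n ≤ toNat π j + k → toNat π j < toNat π i

/-- The last `k` entries of `π` are in decreasing order. -/
def LastDecreasing {n : ℕ} (π : Equiv.Perm (Fin n)) (k : ℕ) : Prop :=
  ∀ i j, i < j → j < n → n ≤ i + k → toNat π j < toNat π i

/-- The `1324`-avoiders whose `k` smallest values are in decreasing order. -/
def starters (n k : ℕ) : Set (Equiv.Perm (Fin n)) := {π | PermAvoids π ∧ BottomDecreasing π k}

/-- The `1324`-avoiders whose `k₁` largest values and `k₂` smallest values are in decreasing
order. -/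
def blocks (n k₁ k₂ : ℕ) : Set (Equiv.Perm (Fin n)) :=
  {π | PermAvoids π ∧ TopDecreasing π k₁ ∧ BottomDecreasing π k₂}

/-- The `1324`-avoiders whose last `k` entries are in decreasing order. -/
def enders (n k : ℕ) : Set (Equiv.Perm (Fin n)) := {π | PermAvoids π ∧ LastDecreasing π k}

/-- Reflection in the antidiagonal. -/
def reflect {n : ℕ} (π : Equiv.Perm (Fin n)) : Equiv.Perm (Fin n) :=
  (Fin.revPerm.trans π.symm).trans Fin.revPerm

theorem toNat_reflect {n : ℕ} (π : Equiv.Perm (Fin n)) {i : ℕ} (hi : i < n) :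
    toNat (reflect π) i = n - 1 - toNat π.symm (n - 1 - i) := by
  have : n - 1 - i < n := by omega
  have e : Fin.rev ⟨i, hi⟩ = ⟨n - 1 - i, this⟩ := by ext; simp; omega
  simp [toNat, hi, this, reflect, e]
  omega

theorem reflect_injective {n : ℕ} : Function.Injective (reflect (n := n)) := by
  intro π ρ h
  have h1 : π.symm = ρ.symm := by
    ext i
    have := congrArg (fun σ : Equiv.Perm (Fin n) => σ (Fin.rev i)) h
    simp [reflect] at this
    rw [this]
  simpa using congrArg Equiv.symm h1

/-- Antidiagonal reflection fixes 1324 and exchanges smallest values with last positions, so the end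
of one block can serve as the overlap with the next. -/
theorem reflect_mem_enders {n k : ℕ} {π : Equiv.Perm (Fin n)} (h : π ∈ starters n k) :
    reflect π ∈ enders n k := by
  obtain ⟨h1, h2⟩ := h
  have hlt : ∀ i, i < n → toNat π.symm (n - 1 - i) < n := fun i hi => toNat_lt _ (by omega)
  refine ⟨?_, ?_⟩
  · intro i j k l hij hjk hkl hl a1 a2 a3
    rw [toNat_reflect π (by omega), toNat_reflect π (by omega)] at a1 a2 a3
    have b1 := hlt i (by omega)
    have b2 := hlt j (by omega)
    have b3 := hlt k (by omega)
    have b4 := hlt l (by omega)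
    refine h1 (toNat π.symm (n - 1 - l)) (toNat π.symm (n - 1 - j))
      (toNat π.symm (n - 1 - k)) (toNat π.symm (n - 1 - i)) ?_ ?_ ?_ b1 ?_ ?_ ?_
    any_goals omega
    all_goals
      rw [toNat_symm, toNat_symm]; omega
  · intro i j hij hj hik
    rw [toNat_reflect π hj, toNat_reflect π (by omega)]
    have b1 := hlt i (by omega)
    have b2 := hlt j (by omega)
    by_contra hcon
    rcases lt_trichotomy (toNat π.symm (n - 1 - j)) (toNat π.symm (n - 1 - i)) with hlt' | heq | hgt
    · have := h2 _ _ hlt' b1 (by rw [toNat_symm]; omega) (by rw [toNat_symm]; omega)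
      rw [toNat_symm, toNat_symm] at this
      omega
    · have := congrArg (toNat π) heq
      rw [toNat_symm, toNat_symm] at this
      omega
    · omega

/-- Rotation by a half turn. -/
def rotate {n : ℕ} (π : Equiv.Perm (Fin n)) : Equiv.Perm (Fin n) :=
  (Fin.revPerm.trans π).trans Fin.revPerm

theorem toNat_rotate {n : ℕ} (π : Equiv.Perm (Fin n)) {i : ℕ} (hi : i < n) :
    toNat (rotate π) i = n - 1 - toNat π (n - 1 - i) := by
  have : n - 1 - i < n := by omega
  have e : Fin.rev ⟨i, hi⟩ = ⟨n - 1 - i, this⟩ := by ext; simp; omega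
  simp [toNat, hi, this, rotate, e]
  omega

theorem rotate_injective {n : ℕ} : Function.Injective (rotate (n := n)) := by
  intro π ρ h
  ext i
  have := congrArg (fun σ : Equiv.Perm (Fin n) => σ (Fin.rev i)) h
  simp [rotate] at this
  rw [this]

theorem rotate_mem_blocks {n k₁ k₂ : ℕ} {π : Equiv.Perm (Fin n)} (h : π ∈ blocks n k₁ k₂) :
    rotate π ∈ blocks n k₂ k₁ := by
  obtain ⟨h1, h2, h3⟩ := h
  have hlt : ∀ i, i < n → toNat π (n - 1 - i) < n := fun i hi => toNat_lt _ (by omega)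
  refine ⟨?_, ?_, ?_⟩
  · intro i j k l hij hjk hkl hl a1 a2 a3
    rw [toNat_rotate π (by omega), toNat_rotate π (by omega)] at a1 a2 a3
    have b1 := hlt i (by omega)
    have b2 := hlt j (by omega)
    have b3 := hlt k (by omega)
    have b4 := hlt l (by omega)
    exact h1 (n - 1 - l) (n - 1 - k) (n - 1 - j) (n - 1 - i) (by omega) (by omega) (by omega)
      (by omega) (by omega) (by omega) (by omega)
  · intro i j hij hj hi1 hj1
    rw [toNat_rotate π (by omega)] at hi1 hj1 ⊢
    rw [toNat_rotate π (by omega)]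
    have b1 := hlt i (by omega)
    have b2 := hlt j (by omega)
    have := h3 (n - 1 - j) (n - 1 - i) (by omega) (by omega) (by omega) (by omega)
    omega
  · intro i j hij hj hi1 hj1
    rw [toNat_rotate π (by omega)] at hi1 hj1 ⊢
    rw [toNat_rotate π (by omega)]
    have b1 := hlt i (by omega)
    have b2 := hlt j (by omega)
    have := h2 (n - 1 - j) (n - 1 - i) (by omega) (by omega) (by omega) (by omega)
    omega

theorem ncard_blocks_swap (n k₁ k₂ : ℕ) : (blocks n k₁ k₂).ncard ≤ (blocks n k₂ k₁).ncard :=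
  Set.ncard_le_ncard_of_injOn rotate (fun _ h => rotate_mem_blocks h)
    rotate_injective.injOn (Set.toFinite _)

theorem ncard_starters_le_ncard_enders (n k : ℕ) : (starters n k).ncard ≤ (enders n k).ncard :=
  Set.ncard_le_ncard_of_injOn reflect (fun _ h => reflect_mem_enders h)
    reflect_injective.injOn (Set.toFinite _)

theorem IsBlock.exists_mem_blocks {n k₁ k₂ : ℕ} {q : List ℕ} (h : IsBlock n k₁ k₂ q) :
    ∃ π ∈ blocks n k₁ k₂, (List.finRange n).map (fun i => (π i : ℕ)) = q := by
  have hlen : q.length = n := by simpa using h.perm.length_eq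
  have hnd : q.Nodup := h.perm.nodup_iff.2 List.nodup_range
  obtain ⟨π, hπ⟩ := exists_perm_toNat (n := n) (fun i => q.getD i 0) (by
      intro i hi
      have : q[i]'(by omega) ∈ List.range n := h.perm.subset (List.getElem_mem _)
      simpa [List.getD_eq_getElem, hlen, hi] using this) (by
      intro i hi j hj e
      rw [List.getD_eq_getElem _ _ (by omega), List.getD_eq_getElem _ _ (by omega)] at e
      exact (hnd.getElem_inj_iff).1 e)
  have hq : (List.finRange n).map (fun i => (π i : ℕ)) = q := by
    refine List.ext_getElem (by simp [hlen]) ?_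
    intro i h1 h2
    have := hπ i (by omega)
    simp only [List.getElem_map, List.getElem_finRange]
    rw [← toNat_val]
    simpa [List.getD_eq_getElem, h2] using this
  have hsub : ∀ s : List (Fin n), s.Pairwise (· < ·) →
      (s.map fun i => (π i : ℕ)).Sublist q := by
    intro s hs
    rw [← hq]
    refine List.Sublist.map _ ?_
    exact List.sublist_of_subperm_of_pairwise (r := (· < ·))
      (List.subperm_of_subset (hs.imp ne_of_lt) fun i _ => List.mem_finRange i) hs
      (List.pairwise_lt_finRange n)
  refine ⟨π, ⟨?_, ?_, ?_⟩, hq⟩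
  · intro i j k l hij hjk hkl hl a1 a2 a3
    have := hsub [⟨i, by omega⟩, ⟨j, by omega⟩, ⟨k, by omega⟩, ⟨l, hl⟩] (by simp; omega)
    simp only [List.map_cons, List.map_nil, ← toNat_val] at this
    exact h.avoids _ _ _ _ this a1 a2 a3
  · intro i j hij hj hi1 hj1
    have := hsub [⟨i, by omega⟩, ⟨j, by omega⟩] (by simp; omega)
    simp only [List.map_cons, List.map_nil, ← toNat_val] at this
    have := h.top.sublist (sublist_filter_of_forall _ this (by simp; omega))
    simpa using this
  · intro i j hij hj hi1 hj1
    have := hsub [⟨i, by omega⟩, ⟨j, by omega⟩] (by simp; omega)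
    simp only [List.map_cons, List.map_nil, ← toNat_val] at this
    have := h.bottom.sublist (sublist_filter_of_forall _ this (by simp; omega))
    simpa using this

theorem card_le_ncard_blocks {n k₁ k₂ : ℕ} (G : Finset (List ℕ))
    (hG : ∀ q ∈ G, IsBlock n k₁ k₂ q) : G.card ≤ (blocks n k₁ k₂).ncard := by
  rw [← Set.ncard_coe_finset]
  refine le_trans (Set.ncard_le_ncard (t := (fun π : Equiv.Perm (Fin n) =>
    (List.finRange n).map (fun i => (π i : ℕ))) '' blocks n k₁ k₂) ?_ (Set.toFinite _))
    (Set.ncard_image_le (Set.toFinite _))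
  intro q hq
  obtain ⟨π, hπ, e⟩ := (hG q hq).exists_mem_blocks
  exact ⟨π, hπ, e⟩

/-! ### Gluing along a shared decreasing sequence -/

section Glue

variable {N s k₁ k₂ : ℕ}

/-- Glue a permutation `σ` of length `N` and a permutation `τ` of length `s + k₁` along the last
`k₁` entries of `σ` and the `k₁` largest values of `τ`. -/
def glue (σ : Equiv.Perm (Fin N)) (τ : Equiv.Perm (Fin (s + k₁))) (i : ℕ) : ℕ :=
  if i + k₁ < N then toNat σ i + s
  else if toNat τ (i + k₁ - N) < s then toNat τ (i + k₁ - N)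
  else toNat σ (N - 1 - (toNat τ (i + k₁ - N) - s)) + s

/-- The position `i` of the glued permutation belongs to a point of the first permutation. -/
def IsOld (N : ℕ) (τ : Equiv.Perm (Fin (s + k₁))) (i : ℕ) : Prop :=
  i + k₁ < N ∨ s ≤ toNat τ (i + k₁ - N)

/-- The position in the first permutation of a point of the glued permutation. -/
def oldPos (N : ℕ) (τ : Equiv.Perm (Fin (s + k₁))) (i : ℕ) : ℕ :=
  if i + k₁ < N then i else N - 1 - (toNat τ (i + k₁ - N) - s)

theorem glue_of_isOld {σ : Equiv.Perm (Fin N)} {τ : Equiv.Perm (Fin (s + k₁))} {i : ℕ}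
    (h : IsOld N τ i) : glue σ τ i = toNat σ (oldPos N τ i) + s := by
  unfold glue oldPos
  by_cases h1 : i + k₁ < N
  · simp [h1]
  · have h2 : ¬ toNat τ (i + k₁ - N) < s := by
      rcases h with h | h <;> omega
    simp [h1, h2]

theorem glue_of_not_isOld {σ : Equiv.Perm (Fin N)} {τ : Equiv.Perm (Fin (s + k₁))} {i : ℕ}
    (h : ¬ IsOld N τ i) : glue σ τ i = toNat τ (i + k₁ - N) := by
  simp only [IsOld, not_or, not_lt, not_le] at h
  simp [glue, h.1, h.2]

theorem glue_lt_iff_not_isOld {σ : Equiv.Perm (Fin N)} {τ : Equiv.Perm (Fin (s + k₁))} {i : ℕ} :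
    glue σ τ i < s ↔ ¬ IsOld N τ i := by
  by_cases h : IsOld N τ i
  · rw [glue_of_isOld h]; simp [h]
  · rw [glue_of_not_isOld h]
    simp only [IsOld, not_or, not_lt, not_le] at h
    simp [IsOld, h.1, h.2]

theorem oldPos_lt (hk : k₁ ≤ N) {τ : Equiv.Perm (Fin (s + k₁))} {i : ℕ} (hi : i < N + s)
    (h : IsOld N τ i) : oldPos N τ i < N := by
  unfold oldPos
  split_ifs with h1
  · omega
  · have : toNat τ (i + k₁ - N) < s + k₁ := toNat_lt τ (by omega)
    rcases h with h | h <;> omega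

/-- The shared points decrease in both permutations: the value `s + j` of `τ` is the entry at
position `N - 1 - j` of `σ`. -/
theorem oldPos_strictMono (hk : k₁ ≤ N) {τ : Equiv.Perm (Fin (s + k₁))}
    (hτ : TopDecreasing τ k₁) {i j : ℕ} (hij : i < j) (hj : j < N + s) (hi' : IsOld N τ i)
    (hj' : IsOld N τ j) : oldPos N τ i < oldPos N τ j := by
  unfold oldPos IsOld at *
  split_ifs with h1 h2 h2
  · exact hij
  · have : toNat τ (j + k₁ - N) < s + k₁ := toNat_lt τ (by omega)
    omega
  · omega
  · have h3 : toNat τ (j + k₁ - N) < s + k₁ := toNat_lt τ (by omega)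
    have h4 : toNat τ (i + k₁ - N) < s + k₁ := toNat_lt τ (by omega)
    have := hτ (i + k₁ - N) (j + k₁ - N) (by omega) (by omega) (by omega) (by omega)
    omega

theorem glue_lt (hk : k₁ ≤ N) {σ : Equiv.Perm (Fin N)} {τ : Equiv.Perm (Fin (s + k₁))} {i : ℕ}
    (hi : i < N + s) : glue σ τ i < N + s := by
  by_cases h : IsOld N τ i
  · rw [glue_of_isOld h]
    have := toNat_lt σ (oldPos_lt hk hi h)
    omega
  · have := (glue_lt_iff_not_isOld (σ := σ)).2 h
    omega

theorem glue_inj (hk : k₁ ≤ N) {σ : Equiv.Perm (Fin N)} {τ : Equiv.Perm (Fin (s + k₁))}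
    (hτ : TopDecreasing τ k₁) {i j : ℕ} (hi : i < N + s) (hj : j < N + s)
    (h : glue σ τ i = glue σ τ j) : i = j := by
  by_cases h1 : IsOld N τ i
  · have h2 : IsOld N τ j := by
      by_contra hcon
      have a := (glue_lt_iff_not_isOld (σ := σ)).2 hcon
      rw [← h, glue_lt_iff_not_isOld] at a
      exact a h1
    rw [glue_of_isOld h1, glue_of_isOld h2] at h
    have e := toNat_inj σ (oldPos_lt hk hi h1) (oldPos_lt hk hj h2) (by omega)
    rcases lt_trichotomy i j with hlt | heq | hgt
    · have := oldPos_strictMono hk hτ hlt hj h1 h2; omega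
    · exact heq
    · have := oldPos_strictMono hk hτ hgt hi h2 h1; omega
  · have h2 : ¬ IsOld N τ j := by
      rw [← glue_lt_iff_not_isOld (σ := σ), ← h, glue_lt_iff_not_isOld]; exact h1
    rw [glue_of_not_isOld h1, glue_of_not_isOld h2] at h
    simp only [IsOld, not_or] at h1 h2
    have := toNat_inj τ (i := i + k₁ - N) (j := j + k₁ - N) (by omega) (by omega) h
    omega

/-- On the part of the second permutation, gluing preserves the order of the values. -/
theorem glue_lt_glue_iff (hk : k₁ ≤ N) {σ : Equiv.Perm (Fin N)} {τ : Equiv.Perm (Fin (s + k₁))}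
    (hσ : LastDecreasing σ k₁) {i j : ℕ}
    (hi : i < s + k₁) (hj : j < s + k₁) :
    glue σ τ (i + (N - k₁)) < glue σ τ (j + (N - k₁)) ↔ toNat τ i < toNat τ j := by
  have hmono : ∀ i j, i < s + k₁ → j < s + k₁ → toNat τ i < toNat τ j →
      glue σ τ (i + (N - k₁)) < glue σ τ (j + (N - k₁)) := by
    intro i j hi hj hlt
    have ei : i + (N - k₁) + k₁ - N = i := by omega
    have ej : j + (N - k₁) + k₁ - N = j := by omega
    have ni : ¬ (i + (N - k₁) + k₁ < N) := by omega
    have nj : ¬ (j + (N - k₁) + k₁ < N) := by omega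
    have bj := toNat_lt τ hj
    simp only [glue, ei, ej, ni, nj, if_false]
    split_ifs with h1 h2 h2
    · exact hlt
    · omega
    · omega
    -- On the overlap a larger value of `τ` means an earlier position in `σ`, hence again a larger
    -- value.
    · have := hσ (N - 1 - (toNat τ j - s)) (N - 1 - (toNat τ i - s)) (by omega) (by omega)
        (by omega)
      omega
  refine ⟨fun h => ?_, hmono i j hi hj⟩
  rcases lt_trichotomy (toNat τ i) (toNat τ j) with hlt | heq | hgt
  · exact hlt
  · rw [toNat_inj τ hi hj heq] at h; exact absurd h (lt_irrefl _)
  · have := hmono j i hj hi hgt; omega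

theorem exists_glue_mem_starters (hk₁ : k₁ ≤ N) (hk₂ : k₂ ≤ s) {σ : Equiv.Perm (Fin N)}
    {τ : Equiv.Perm (Fin (s + k₁))} (hσ : σ ∈ enders N k₁) (hτ : τ ∈ blocks (s + k₁) k₁ k₂) :
    ∃ π ∈ starters (N + s) k₂, ∀ i < N + s, toNat π i = glue σ τ i := by
  obtain ⟨hσ1, hσ2⟩ := hσ
  obtain ⟨hτ1, hτ2, hτ3⟩ := hτ
  obtain ⟨π, hπ⟩ := exists_perm_toNat (glue σ τ) (fun i hi => glue_lt hk₁ hi)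
    (fun i hi j hj => glue_inj hk₁ hτ2 hi hj)
  refine ⟨π, ⟨?_, ?_⟩, hπ⟩
  · intro i j k l hij hjk hkl hl a1 a2 a3
    rw [hπ _ (by omega), hπ _ (by omega)] at a1 a2 a3
    -- If the 1 of the occurrence comes before the overlap, it lies above all points private to `τ`,
    -- so the whole occurrence lies in `σ`. Otherwise all four positions belong to `τ`.
    by_cases hi : i + k₁ < N
    · have oi : IsOld N τ i := Or.inl hi
      have key : ∀ m, glue σ τ i < glue σ τ m → IsOld N τ m := by
        intro m hm
        by_contra hcon
        rw [← glue_lt_iff_not_isOld (σ := σ)] at hcon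
        have : glue σ τ i < s := by omega
        exact glue_lt_iff_not_isOld.1 this oi
      have oj := key j (by omega)
      have ok := key k (by omega)
      have ol := key l (by omega)
      rw [glue_of_isOld (by assumption), glue_of_isOld (by assumption)] at a1 a2 a3
      exact hσ1 _ _ _ _ (oldPos_strictMono hk₁ hτ2 hij (by omega) oi oj)
        (oldPos_strictMono hk₁ hτ2 hjk (by omega) oj ok) (oldPos_strictMono hk₁ hτ2 hkl (by omega) ok ol)
        (oldPos_lt hk₁ hl ol) (by omega) (by omega) (by omega)
    · have key : ∀ a, i ≤ a → ∃ b, a = b + (N - k₁) := fun a ha =>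
        ⟨a - (N - k₁), by omega⟩
      obtain ⟨i', rfl⟩ := key i (by omega)
      obtain ⟨j', rfl⟩ := key j (by omega)
      obtain ⟨k', rfl⟩ := key k (by omega)
      obtain ⟨l', rfl⟩ := key l (by omega)
      rw [glue_lt_glue_iff hk₁ hσ2 (by omega) (by omega)] at a1 a2 a3
      exact hτ1 i' j' k' l' (by omega) (by omega) (by omega) (by omega) a1 a2 a3
  · intro i j hij hj hi1 hj1
    rw [hπ _ (by omega)] at hi1 hj1 ⊢
    rw [hπ _ (by omega)]
    have oi := glue_lt_iff_not_isOld.1 (lt_of_lt_of_le hi1 hk₂)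
    have oj := glue_lt_iff_not_isOld.1 (lt_of_lt_of_le hj1 hk₂)
    rw [glue_of_not_isOld oi] at hi1 ⊢
    rw [glue_of_not_isOld oj] at hj1 ⊢
    simp only [IsOld, not_or] at oi oj
    exact hτ3 _ _ (by omega) (by omega) hi1 hj1

theorem glue_injective (hk₁ : k₁ ≤ N) {σ σ' : Equiv.Perm (Fin N)}
    {τ τ' : Equiv.Perm (Fin (s + k₁))} (hσ : LastDecreasing σ k₁) (hσ' : LastDecreasing σ' k₁)
    (h : ∀ i < N + s, glue σ τ i = glue σ' τ' i) : σ = σ' ∧ τ = τ' := by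
  have hτ : τ = τ' := by
    refine eq_of_toNat_lt_iff fun i hi j hj => ?_
    rw [← glue_lt_glue_iff hk₁ hσ hi hj, ← glue_lt_glue_iff hk₁ hσ' hi hj, h _ (by omega),
      h _ (by omega)]
  subst hτ
  refine ⟨ext_toNat fun p hp => ?_, rfl⟩
  -- Every position of `σ` survives: one of the last `k₁` positions `p` is found where `τ` takes the
  -- value `s + (N - 1 - p)`.
  have key : ∃ i < N + s, IsOld N τ i ∧ oldPos N τ i = p := by
    by_cases hp' : p + k₁ < N
    · exact ⟨p, by omega, Or.inl hp', by simp [oldPos, hp']⟩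
    · have hb : toNat τ.symm (s + (N - 1 - p)) < s + k₁ := toNat_lt _ (by omega)
      refine ⟨toNat τ.symm (s + (N - 1 - p)) + (N - k₁), by omega, ?_, ?_⟩
      · right
        rw [show toNat τ.symm (s + (N - 1 - p)) + (N - k₁) + k₁ - N
          = toNat τ.symm (s + (N - 1 - p)) by omega, toNat_symm]
        omega
      · rw [oldPos, if_neg (by omega), show toNat τ.symm (s + (N - 1 - p)) + (N - k₁) + k₁ - N
          = toNat τ.symm (s + (N - 1 - p)) by omega, toNat_symm]
        omega
  obtain ⟨i, hi, hold, rfl⟩ := key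
  have := h i hi
  rw [glue_of_isOld hold, glue_of_isOld hold] at this
  omega

theorem ncard_starters_mul_le (hk₁ : k₁ ≤ N) (hk₂ : k₂ ≤ s) :
    (starters N k₁).ncard * (blocks (s + k₁) k₁ k₂).ncard ≤ (starters (N + s) k₂).ncard := by
  refine (Nat.mul_le_mul_right _ (ncard_starters_le_ncard_enders N k₁)).trans ?_
  rw [← Set.ncard_prod]
  choose! f hf using fun p : Equiv.Perm (Fin N) × Equiv.Perm (Fin (s + k₁)) =>
    fun h : p ∈ enders N k₁ ×ˢ blocks (s + k₁) k₁ k₂ => exists_glue_mem_starters hk₁ hk₂ h.1 h.2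
  refine Set.ncard_le_ncard_of_injOn f (fun p hp => (hf p hp).1) ?_ (Set.toFinite _)
  intro p hp q hq e
  have := glue_injective hk₁ hp.1.2 hq.1.2 (τ := p.2) (τ' := q.2) fun i hi => by
    rw [← (hf p hp).2 i hi, ← (hf q hq).2 i hi, e]
  exact Prod.ext this.1 this.2

end Glue

/-! ### Chains of blocks and the passage to involutions -/

theorem ncard_starters_pos (k : ℕ) : 0 < (starters k k).ncard := by
  obtain ⟨π, hπ⟩ := exists_perm_toNat (n := k) (fun i => k - 1 - i) (by omega) (by omega)
  refine (Set.ncard_pos (Set.toFinite _)).2 ⟨π, ?_, ?_⟩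
  · intro i j k l hij hjk hkl hl a1
    rw [hπ _ (by omega), hπ _ (by omega)] at a1
    omega
  · intro i j hij hj _ _
    rw [hπ _ (by omega), hπ _ (by omega)]
    omega

/-- A chain of `2ℓ` blocks. -/
theorem pow_ncard_blocks_le {n k₁ k₂ : ℕ} (ℓ : ℕ) :
    (blocks (k₂ + n + k₁) k₁ k₂).ncard ^ (2 * ℓ)
      ≤ (starters (k₁ + ℓ * (2 * n + k₁ + k₂)) k₁).ncard := by
  induction ℓ with
  | zero =>
    rw [zero_mul, add_zero, mul_zero, pow_zero]
    exact ncard_starters_pos k₁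
  | succ ℓ ih =>
    set w := (blocks (k₂ + n + k₁) k₁ k₂).ncard with hw
    have h1 := ncard_starters_mul_le (N := k₁ + ℓ * (2 * n + k₁ + k₂)) (s := k₂ + n) (k₁ := k₁)
      (k₂ := k₂) (by omega) (by omega)
    -- The second block of each pair is rotated by a half turn, which exchanges `k₁` and `k₂` and
    -- lets the chain continue with `k₁`.
    have h2 := ncard_starters_mul_le (N := k₁ + ℓ * (2 * n + k₁ + k₂) + (k₂ + n)) (s := k₁ + n)
      (k₁ := k₂) (k₂ := k₁) (by omega) (by omega)
    have h3 : w ≤ (blocks (k₁ + n + k₂) k₂ k₁).ncard := by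
      rw [show k₁ + n + k₂ = k₂ + n + k₁ by omega]
      exact ncard_blocks_swap _ _ _
    rw [show k₁ + (ℓ + 1) * (2 * n + k₁ + k₂)
      = k₁ + ℓ * (2 * n + k₁ + k₂) + (k₂ + n) + (k₁ + n) by ring]
    refine le_trans ?_ h2
    calc w ^ (2 * (ℓ + 1)) = w ^ (2 * ℓ) * w * w := by ring
      _ ≤ (starters (k₁ + ℓ * (2 * n + k₁ + k₂)) k₁).ncard * w * w := by gcongr
      _ ≤ (starters (k₁ + ℓ * (2 * n + k₁ + k₂) + (k₂ + n)) k₂).ncard * w := by gcongr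
      _ ≤ _ := by gcongr

/-- The involution `π ⊖ π⁻¹`. -/
theorem exists_involution {N : ℕ} {π : Equiv.Perm (Fin N)} (h : PermAvoids π) :
    ∃ ρ ∈ avoidingInvolutions pattern1324 (N + N), ∀ i < N, toNat ρ i = N + toNat π i := by
  set f : ℕ → ℕ := fun i => if i < N then N + toNat π i else toNat π.symm (i - N) with hf
  have f1 : ∀ i < N, f i = N + toNat π i := fun i hi => by simp [hf, hi]
  have f2 : ∀ i, f (N + i) = toNat π.symm i := fun i => by simp [hf]
  have hlt : ∀ i < N + N, f i < N + N := by
    intro i hi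
    by_cases h1 : i < N
    · rw [f1 i h1]; have := toNat_lt π h1; omega
    · obtain ⟨j, rfl⟩ : ∃ j, i = N + j := ⟨i - N, by omega⟩
      rw [f2]; have := toNat_lt π.symm (i := j) (by omega); omega
  have hinv : ∀ i < N + N, f (f i) = i := by
    intro i hi
    by_cases h1 : i < N
    · rw [f1 i h1, f2, toNat_symm']
    · obtain ⟨j, rfl⟩ : ∃ j, i = N + j := ⟨i - N, by omega⟩
      rw [f2, f1 _ (toNat_lt _ (by omega)), toNat_symm]
  obtain ⟨ρ, hρ⟩ := exists_perm_toNat f hlt (fun i hi j hj e => by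
    rw [← hinv i hi, ← hinv j hj, e])
  refine ⟨ρ, ⟨?_, ?_⟩, fun i hi => by rw [hρ i (by omega), f1 i hi]⟩
  · intro i
    apply Fin.ext
    rw [← toNat_val ρ (ρ i), ← toNat_val ρ i, hρ i i.2, hρ _ (hlt i i.2), hinv i i.2]
  · refine PermAvoids.not_containsPattern ?_
    intro i j k l hij hjk hkl hl a1 a2 a3
    rw [hρ _ (by omega), hρ _ (by omega)] at a1 a2 a3
    by_cases hi : i < N
    · have key : ∀ m < N + N, f i < f m → m < N := by
        intro m hm hlt'
        by_contra hcon
        obtain ⟨m', rfl⟩ : ∃ m', m = N + m' := ⟨m - N, by omega⟩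
        rw [f2, f1 i hi] at hlt'
        have := toNat_lt π.symm (i := m') (by omega)
        omega
      have hl' := key l hl (by omega)
      rw [f1 _ (by omega), f1 _ (by omega)] at a1 a2 a3
      exact h i j k l hij hjk hkl hl' (by omega) (by omega) (by omega)
    · obtain ⟨i', rfl⟩ : ∃ m', i = N + m' := ⟨i - N, by omega⟩
      obtain ⟨j', rfl⟩ : ∃ m', j = N + m' := ⟨j - N, by omega⟩
      obtain ⟨k', rfl⟩ : ∃ m', k = N + m' := ⟨k - N, by omega⟩
      obtain ⟨l', rfl⟩ : ∃ m', l = N + m' := ⟨l - N, by omega⟩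
      rw [f2, f2] at a1 a2 a3
      exact h.symm i' j' k' l' (by omega) (by omega) (by omega) (by omega) a1 a2 a3

theorem ncard_starters_le_involutions (N k : ℕ) :
    (starters N k).ncard ≤ (avoidingInvolutions pattern1324 (N + N)).ncard := by
  choose! f hf using fun (π : Equiv.Perm (Fin N)) (h : PermAvoids π) => exists_involution h
  refine Set.ncard_le_ncard_of_injOn f (fun π hπ => (hf π hπ.1).1) ?_ (Set.toFinite _)
  intro π hπ ρ hρ e
  refine ext_toNat fun i hi => ?_
  have h1 := (hf π hπ.1).2 i hi
  have h2 := (hf ρ hρ.1).2 i hi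
  rw [e, h2] at h1
  omega

/-! ### Numerical estimates -/

/-- One term of Vandermonde's convolution. -/
theorem choose_mul_choose_le (m n i j : ℕ) :
    m.choose i * n.choose j ≤ (m + n).choose (i + j) := by
  rw [Nat.add_choose_eq]
  exact Finset.single_le_sum (f := fun p : ℕ × ℕ => m.choose p.1 * n.choose p.2)
    (fun _ _ => Nat.zero_le _) (a := (i, j)) (Finset.HasAntidiagonal.mem_antidiagonal.2 rfl)

theorem choose_pow_le (m i a : ℕ) : m.choose i ^ a ≤ (m * a).choose (i * a) := by
  induction a with
  | zero => simp
  | succ a ih =>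
    rw [pow_succ, Nat.mul_succ, Nat.mul_succ]
    exact (Nat.mul_le_mul_right _ ih).trans (choose_mul_choose_le _ _ _ _)

/-- The exponent 25 makes the square of the bound a 50th power. As 50 also divides 1500 and 350,
`one_lt_block_rate` reduces to an inequality with small exponents. -/
theorem pow_le_choose_eleven_hundred : 760000000000 ^ 25 ≤ (1100 : ℕ).choose 350 := by
  rw [Nat.choose_eq_descFactorial_div_factorial, Nat.le_div_iff_mul_le (Nat.factorial_pos _)]
  norm_num only

/-- The exponential rate that a block gains over `3.13` per `750` letters of its domino. -/
theorem one_lt_block_rate :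
    (1 : ℝ) < (6.72 / 9.7969) ^ 1500 * ((1100 : ℕ).choose 350 : ℝ) ^ 2 / 9.7969 ^ 350 := by
  have h0 := pow_le_choose_eleven_hundred
  generalize (1100 : ℕ).choose 350 = b at h0 ⊢
  have h : ((760000000000 : ℝ) ^ 25) ≤ (b : ℝ) := by exact_mod_cast h0
  have h1 : (1 : ℝ) < (6.72 / 9.7969) ^ 30 * 760000000000 / 9.7969 ^ 7 := by norm_num
  calc (1 : ℝ) < ((6.72 / 9.7969) ^ 30 * 760000000000 / 9.7969 ^ 7) ^ 50 :=
        one_lt_pow₀ h1 (by norm_num)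
    _ = (6.72 / 9.7969) ^ 1500 * (760000000000 ^ 25) ^ 2 / 9.7969 ^ 350 := by
        rw [div_pow, mul_pow, ← pow_mul, ← pow_mul, ← pow_mul]
    _ ≤ _ := by gcongr

/-- Blocks built from the dominoes of length `n`, with the sizes of the added sequences
proportional to those of the two rows. -/
theorem exists_le_ncard_blocks (n : ℕ) :
    ∃ a k₁ k₂ : ℕ, k₁ + k₂ = 350 * a ∧ 750 * a ≤ n ∧ n ≤ 750 * a + 1500 ∧
      dominoCount n * (1100 : ℕ).choose 350 ^ a
        ≤ (n + 1) * (blocks (k₂ + n + k₁) k₁ k₂).ncard := by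
  obtain ⟨m₁, m₂, hm, F, hF, hF'⟩ := exists_finset_isDomino n
  obtain ⟨G, hG, hG'⟩ := exists_finset_isBlock (350 * (m₁ / 750)) (350 * (m₂ / 750)) F hF'
  have hW := card_le_ncard_blocks G hG'
  refine ⟨m₁ / 750 + m₂ / 750, 350 * (m₁ / 750), 350 * (m₂ / 750), by ring, by omega, by omega, ?_⟩
  -- Each full group of 750 letters of a cell receives 350 added letters, and 1100 = 750 + 350.
  have hc (m : ℕ) :
      (1100 : ℕ).choose 350 ^ (m / 750) ≤ (350 * (m / 750) + m).choose (350 * (m / 750)) :=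
    (choose_pow_le _ _ _).trans (Nat.choose_le_choose _ (by omega))
  have h2 := hc m₂
  rw [Nat.choose_symm_add, Nat.add_comm] at h2
  calc dominoCount n * (1100 : ℕ).choose 350 ^ (m₁ / 750 + m₂ / 750)
      ≤ (n + 1) * F.card * ((1100 : ℕ).choose 350 ^ (m₁ / 750)
        * (1100 : ℕ).choose 350 ^ (m₂ / 750)) := by
        rw [pow_add]; gcongr
    _ ≤ (n + 1) * F.card * ((350 * (m₁ / 750) + m₁).choose (350 * (m₁ / 750))
        * (m₂ + 350 * (m₂ / 750)).choose m₂) := by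
        gcongr
        exact hc m₁
    _ = (n + 1) * G.card := by rw [hG]; ring
    _ ≤ _ := by gcongr

theorem eventually_pow_lt_mul_pow {c δ γ : ℝ} (hc : 0 < c) (hδ : 0 < δ) (hγ : 1 < γ) :
    ∀ᶠ a : ℕ in Filter.atTop, (c * ((a : ℝ) + 1)) ^ 4 < δ * γ ^ a := by
  have hγ0 : 0 < γ := by linarith
  have hε : 0 < δ / (c ^ 4 * γ) := by positivity
  have hlim := tendsto_pow_const_mul_const_pow_of_abs_lt_one 4 (r := γ⁻¹)
    (by rw [abs_of_pos (inv_pos.2 hγ0)]; exact inv_lt_one_of_one_lt₀ hγ)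
  filter_upwards [(Filter.tendsto_add_atTop_nat 1).eventually (hlim.eventually (gt_mem_nhds hε))]
    with a h1
  rw [inv_pow, ← div_eq_mul_inv, div_lt_div_iff₀ (by positivity) (by positivity)] at h1
  push_cast at h1
  rw [pow_succ γ] at h1
  refine lt_of_mul_lt_mul_right ?_ hγ0.le
  linarith

theorem exists_pow_lt_ncard_blocks_sq :
    ∃ n k₁ k₂ : ℕ, 0 < 2 * n + k₁ + k₂ ∧
      (9.7969 : ℝ) ^ (2 * n + k₁ + k₂) < ((blocks (k₂ + n + k₁) k₁ k₂).ncard : ℝ) ^ 2 := by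
  obtain ⟨b, hb⟩ : ∃ b, b = (1100 : ℕ).choose 350 := ⟨_, rfl⟩
  obtain ⟨q, hq⟩ : ∃ q : ℝ, q = 6.72 / 9.7969 := ⟨_, rfl⟩
  have hγ1 := one_lt_block_rate
  rw [← hq, ← hb] at hγ1
  obtain ⟨β, hβ⟩ : ∃ β : ℝ, β = b := ⟨_, rfl⟩
  rw [← hβ] at hγ1
  obtain ⟨γ, hγ⟩ : ∃ γ, γ = q ^ 1500 * β ^ 2 / 9.7969 ^ 350 := ⟨_, rfl⟩
  rw [← hγ] at hγ1
  have hβ0 : 0 ≤ β := hβ ▸ Nat.cast_nonneg b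
  have hγ0 : 0 < γ := by linarith
  have hq0 : 0 < q := by rw [hq]; norm_num
  have hq1 : q ≤ 1 := by rw [hq]; norm_num
  -- Rounding leaves `2 * n ≤ 1500 * a + 3000`; since `q ≤ 1`, the excess costs at most the factor
  -- `q ^ 3000`.
  obtain ⟨δ, hδ⟩ : ∃ δ, δ = q ^ 3000 := ⟨_, rfl⟩
  have hδ0 : 0 < δ := hδ ▸ pow_pos hq0 _
  obtain ⟨B, hB⟩ := Filter.eventually_atTop.1
    (eventually_pow_lt_mul_pow (c := 1501) (by norm_num) hδ0 hγ1)
  -- With `n ≤ 750 * a + 1500` this bound on `n` forces `a ≥ B`, and it also makes `n` positive.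
  obtain ⟨n, hn, hn'⟩ := Filter.frequently_atTop.1 frequently_dominoCount (750 * B + 1501)
  obtain ⟨a, k₁, k₂, hk, ha, ha', hW⟩ := exists_le_ncard_blocks n
  rw [← hb] at hW
  refine ⟨n, k₁, k₂, by omega, ?_⟩
  set W := (blocks (k₂ + n + k₁) k₁ k₂).ncard
  have h2 := hB a (by omega)
  have hWr : (dominoCount n : ℝ) * β ^ a ≤ (n + 1) * W := by
    subst hβ
    exact_mod_cast hW
  have h3 : (6.72 : ℝ) ^ n * β ^ a ≤ n * (n + 1) * W := by
    calc (6.72 : ℝ) ^ n * β ^ a ≤ n * dominoCount n * β ^ a := by gcongr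
      _ = n * (dominoCount n * β ^ a) := by ring
      _ ≤ n * ((n + 1) * W) := mul_le_mul_of_nonneg_left hWr n.cast_nonneg
      _ = _ := by ring
  have hna : (n : ℝ) + 1 ≤ 1501 * (a + 1) := by
    have : n + 1 ≤ 1501 * (a + 1) := by omega
    exact_mod_cast this
  have h4 : (6.72 : ℝ) ^ n * β ^ a ≤ (1501 * (a + 1)) ^ 2 * W := by
    have hn0 : (0 : ℝ) ≤ n := n.cast_nonneg
    refine h3.trans (mul_le_mul_of_nonneg_right ?_ W.cast_nonneg)
    rw [pow_two]
    exact mul_le_mul ((le_add_of_nonneg_right zero_le_one).trans hna) hna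
      (add_nonneg hn0 zero_le_one) ((add_nonneg hn0 zero_le_one).trans hna)
  have h5 : δ * γ ^ a * 9.7969 ^ (2 * n + k₁ + k₂) ≤ ((6.72 : ℝ) ^ n * β ^ a) ^ 2 := by
    have e1 : δ * γ ^ a * 9.7969 ^ (2 * n + k₁ + k₂)
        = q ^ (1500 * a + 3000) * ((β ^ a) ^ 2 * 9.7969 ^ (2 * n)) := by
      rw [add_assoc, hk, hγ, hδ, div_pow, mul_pow, ← pow_mul, ← pow_mul, ← pow_mul, ← pow_mul,
        pow_add, pow_add, mul_comm a 2]
      field_simp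
    have e2 : ((6.72 : ℝ) ^ n * β ^ a) ^ 2 = q ^ (2 * n) * ((β ^ a) ^ 2 * 9.7969 ^ (2 * n)) := by
      have : (6.72 : ℝ) = q * 9.7969 := by rw [hq]; norm_num
      rw [this, mul_pow, mul_pow, mul_pow, ← pow_mul, ← pow_mul, mul_comm n 2]
      ring
    rw [e1, e2]
    refine mul_le_mul_of_nonneg_right (pow_le_pow_of_le_one hq0.le hq1 (by omega)) (by positivity)
  have hp : (0 : ℝ) < (1501 * ((a : ℝ) + 1)) ^ 4 :=
    pow_pos (mul_pos (by norm_num) a.cast_add_one_pos) _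
  refine lt_of_mul_lt_mul_left ?_ hp.le
  calc (1501 * ((a : ℝ) + 1)) ^ 4 * 9.7969 ^ (2 * n + k₁ + k₂)
      < δ * γ ^ a * 9.7969 ^ (2 * n + k₁ + k₂) := by gcongr
    _ ≤ ((6.72 : ℝ) ^ n * β ^ a) ^ 2 := h5
    _ ≤ ((1501 * (a + 1)) ^ 2 * W) ^ 2 := by gcongr
    _ = _ := by ring

theorem exists_frequently_pow_le_involutions :
    ∃ θ : ℝ, 3.13 < θ ∧ ∃ᶠ n : ℕ in Filter.atTop,
      θ ^ n ≤ (avoidingInvolutions pattern1324 n).ncard := by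
  obtain ⟨n, k₁, k₂, hS, hV⟩ := exists_pow_lt_ncard_blocks_sq
  have hcount := pow_ncard_blocks_le (n := n) (k₁ := k₁) (k₂ := k₂)
  set W := (blocks (k₂ + n + k₁) k₁ k₂).ncard
  set S := 2 * n + k₁ + k₂
  have h0 : (3.13 : ℝ) ^ (2 * S) < (W : ℝ) ^ 2 := by
    rw [pow_mul]; norm_num at hV ⊢; exact hV
  -- The inequality is strict, so it persists for some `θ` slightly above 3.13.
  have hev : ∀ᶠ x : ℝ in nhdsWithin 3.13 (Set.Ioi 3.13), x ^ (2 * S) < (W : ℝ) ^ 2 :=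
    nhdsWithin_le_nhds (((continuous_pow (2 * S)).tendsto 3.13).eventually (gt_mem_nhds h0))
  obtain ⟨θ, hθ, hθ'⟩ := (hev.and self_mem_nhdsWithin).exists
  have hθ3 : (3.13 : ℝ) < θ := hθ'
  have hθ0 : 0 < θ := by linarith
  refine ⟨θ, hθ3, Filter.frequently_atTop.2 fun M => ?_⟩
  -- A long chain gains enough to pay for the factor `θ ^ (2 * k₁)` of the initial decreasing piece.
  have hlim := tendsto_pow_atTop_atTop_of_one_lt (r := (W : ℝ) ^ 2 / θ ^ (2 * S))
    ((one_lt_div (by positivity)).2 hθ)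
  obtain ⟨ℓ, h1, h2⟩ := ((hlim.eventually_ge_atTop (θ ^ (2 * k₁))).and
    (Filter.eventually_ge_atTop M)).exists
  have hM : ℓ ≤ ℓ * S := Nat.le_mul_of_pos_right _ hS
  refine ⟨k₁ + ℓ * S + (k₁ + ℓ * S), by omega, ?_⟩
  have h3 := (hcount ℓ).trans (ncard_starters_le_involutions _ _)
  refine le_trans ?_ (Nat.cast_le.2 h3)
  rw [div_pow, le_div_iff₀ (by positivity), ← pow_mul, ← pow_mul, ← pow_add] at h1
  push_cast
  refine le_trans (le_of_eq ?_) h1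
  congr 1
  ring

end Domino

theorem mainTheorem9 :
    ENNReal.ofReal 3.13 < upperGrowthRate (avoidingInvolutions pattern1324) := by
  obtain ⟨θ, hθ, h⟩ := Domino.exists_frequently_pow_le_involutions
  have hθ0 : 0 < θ := by linarith
  refine ((ENNReal.ofReal_lt_ofReal_iff hθ0).2 hθ).trans_le ?_
  refine Filter.le_limsup_of_frequently_le ?_
  refine (h.and_eventually (Filter.eventually_gt_atTop 0)).mono fun n hn => ?_
  have hn0 : (0 : ℝ) < n := by exact_mod_cast hn.2
  have h1 : ENNReal.ofReal θ ^ (n : ℝ) ≤ ((avoidingInvolutions pattern1324 n).ncard : ENNReal) := by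
    rw [ENNReal.rpow_natCast, ← ENNReal.ofReal_pow hθ0.le, ← ENNReal.ofReal_natCast]
    exact ENNReal.ofReal_le_ofReal hn.1
  have h2 := ENNReal.rpow_le_rpow h1 (one_div_nonneg.2 hn0.le)
  rwa [← ENNReal.rpow_mul, mul_one_div_cancel hn0.ne', ENNReal.rpow_one] at h2
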